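/- Let $L$ be a (possibly many-sorted) $1$-bounded metric signature in continuous first-order logic; structures have nonempty complete metric sorts of diameter at most $1$, and connectives are all continuous functions $[0,1]^n\to[0,1]$. A structure is finite (resp. compact) if every one of its sorts is finite (resp. compact), and an $L$-structure $M$ is pseudofinite (resp. pseudocompact) if $\sigma^M=0$ for every $L$-sentence $\sigma$ such that $\sigma^A=0$ for all finite (resp. compact) $L$-structures $A$. A definable predicate $\psi(x,Y)=\mathcal{F}\lim_n\varphi_n(x,y_n)$ is the forced limit of a sequence of $L$-formulas, where $x$ is a finite tuple of variables, $Y$ is a finite or countable tuple of parameter variables and $y_0\subseteq y_1\subseteq\cdots$ are finite truncations of $Y$ exhausting it. (The forced limit of $(a_n)$ in $[0,1]$ is $\lim_n a'_n$, where $a'_0=a_0$ and $a'_{n+1}$ is the point of $[a'_n-2^{-n-1},a'_n+2^{-n-1}]$ closest to $a_{n+1}$.) The signature $L^{\mathrm{eq}}$ adds to $L$, for each such $\psi$, a sort $S_\psi$ and predicate symbols $P_\psi(x,z)$ and $\gamma_{\psi,n}(y_n,z)$ $(n\in\mathbb{N})$, with $z$ of sort $S_\psi$ and with moduli of uniform continuity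 computed from those of $L$. The $L^{\mathrm{eq}}$-structure $M^{\mathrm{eq}}$ expands $M$: $S_\psi$ is the completion of the set of tuples $b$ of sort $Y$ in $M$ under the pseudometric $d_\psi(b,b')=\sup_x|\psi(x,b)-\psi(x,b')|$ (tuples at distance $0$ being identified), $P_\psi$ is the continuous extension of $P_\psi(x,[b]_\psi)=\psi(x,b)$, and $\gamma_{\psi,n}(y_n,z)=\sup_x|\varphi_n(x,y_n)-P_\psi(x,z)|$. Let $L^{\mathrm{eq}}_{\mathrm{fin}}$ and $M^{\mathrm{eq}}_{\mathrm{fin}}$ be the parts in which only the finitary $\psi$ (those with $Y$ a finite tuple) are used. Then for every $L$-structure $M$: (1) if $M$ is pseudofinite (resp. pseudocompact), then so is the $L^{\mathrm{eq}}$-structure $M^{\mathrm{eq}}$; (2) if $M$ is pseudofinite (resp. pseudocompact), then so is the $L^{\mathrm{eq}}_{\mathrm{fin}}$-structure $M^{\mathrm{eq}}_{\mathrm{fin}}$; (3) if $M$ is finite, then $M^{\mathrm{eq}}_{\mathrm{fin}}$ is finite, and if $M$ is compact, then $M^{\mathrm{eq}}$ is compact. -/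

import Mathlib

/-!
Continuous first-order logic for many-sorted, 1-bounded metric signatures, and the expansion of a
metric structure by sorts of canonical parameters of definable predicates (the "eq" expansion).
-/

universe u w

namespace ContLogic

/-! ### Tuples -/

/-- A tuple of elements whose sorts are listed in `Γ`. -/
abbrev Env {S : Type u} (M : S → Type w) (Γ : List S) : Type w :=
  ∀ i : Fin Γ.length, M (Γ.get i)

namespace Env

variable {S : Type u} {M : S → Type w}

/-- The empty tuple. -/
def nil : Env M [] := fun i => Fin.elim0 i

/-- Put an element in front of a tuple. -/
def cons {a : S} {Γ : List S} (x : M a) (e : Env M Γ) : Env M (a :: Γ) :=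
  fun i => Fin.cons (α := fun i => M ((a :: Γ).get i)) x e i

/-- The first element of a nonempty tuple. -/
def head {a : S} {Γ : List S} (e : Env M (a :: Γ)) : M a := e 0

/-- A nonempty tuple without its first element. -/
def tail {a : S} {Γ : List S} (e : Env M (a :: Γ)) : Env M Γ := fun i => e i.succ

/-- Concatenation of tuples. -/
def append : {Γ Δ : List S} → Env M Γ → Env M Δ → Env M (Γ ++ Δ)
  | [], _, _, e' => e'
  | _ :: _, _, e, e' => cons (head e) (append (tail e) e')

/-- A tuple of elements of sorts `f a`, `a ∈ Γ`, read as a tuple over the family `M ∘ f`. -/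
def unmap {T : Type u} (f : S → T) {N : T → Type w} :
    {Γ : List S} → Env N (Γ.map f) → Env (fun s => N (f s)) Γ
  | [], _ => nil
  | _ :: _, e => cons (M := fun s => N (f s)) (head e) (unmap f (tail e))

theorem cons_rel {R : ∀ s, M s → M s → Prop} {a : S} {Γ : List S} {x x' : M a} {e e' : Env M Γ}
    (hx : R a x x') (he : ∀ i, R _ (e i) (e' i)) : ∀ i, R _ (cons x e i) (cons x' e' i) := by
  intro i
  refine Fin.cases ?_ (fun j => ?_) i
  · exact hx
  · exact he j

theorem append_rel {R : ∀ s, M s → M s → Prop} : ∀ {Γ Δ : List S} {e e' : Env M Γ}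
    {d d' : Env M Δ}, (∀ i, R _ (e i) (e' i)) → (∀ i, R _ (d i) (d' i)) →
    ∀ i, R _ (append e d i) (append e' d' i)
  | [], _, _, _, _, _, _, hd => hd
  | _ :: _, _, _, _, _, _, he, hd =>
    cons_rel (he 0) (append_rel (fun i => he i.succ) hd)

theorem unmap_rel {T : Type u} (f : S → T) {N : T → Type w} {R : ∀ t, N t → N t → Prop} :
    ∀ {Γ : List S} {e e' : Env N (Γ.map f)}, (∀ i, R _ (e i) (e' i)) →
      ∀ i, R _ (unmap f e i) (unmap f e' i)
  | [], _, _, _ => fun i => Fin.elim0 i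
  | _ :: _, _, _, he =>
    cons_rel (M := fun s => N (f s)) (R := fun s => R (f s)) (he ⟨0, Nat.succ_pos _⟩)
      (unmap_rel f (R := R) (fun i => he i.succ))

end Env

/-! ### Signatures and structures -/

/-- A many-sorted, 1-bounded metric signature: function symbols (constants are the 0-ary ones) and
predicate symbols, each with a modulus of uniform continuity. -/
structure Signature : Type (u + 1) where
  Sorts : Type u
  Func : Type u
  Pred : Type u
  dom : Func → List Sorts
  cod : Func → Sorts
  arity : Pred → List Sorts
  funcMod : Func → ℝ → ℝ
  predMod : Pred → ℝ → ℝ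
  funcMod_pos : ∀ f ε, 0 < ε → 0 < funcMod f ε
  predMod_pos : ∀ P ε, 0 < ε → 0 < predMod P ε

/-- A metric structure: every sort is a nonempty complete metric space of diameter at most `1`,
predicates take values in `[0,1]`, and the moduli prescribed by the signature are respected (with
respect to the maximum metric on tuples). -/
structure Signature.Structure (L : Signature.{u}) : Type (max u (w + 1)) where
  carrier : L.Sorts → Type w
  metric : ∀ s, MetricSpace (carrier s)
  complete : ∀ s, CompleteSpace (carrier s)
  nonempty : ∀ s, Nonempty (carrier s)
  dist_le_one : ∀ s (x y : carrier s), dist x y ≤ 1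
  func : ∀ f, Env carrier (L.dom f) → carrier (L.cod f)
  pred : ∀ P, Env carrier (L.arity P) → unitInterval
  func_mod : ∀ f ε, 0 < ε → ∀ e e' : Env carrier (L.dom f),
    (∀ i, dist (e i) (e' i) < L.funcMod f ε) → dist (func f e) (func f e') ≤ ε
  pred_mod : ∀ P ε, 0 < ε → ∀ e e' : Env carrier (L.arity P),
    (∀ i, dist (e i) (e' i) < L.predMod P ε) → dist (pred P e) (pred P e') ≤ ε

attribute [instance] Signature.Structure.metric Signature.Structure.complete
  Signature.Structure.nonempty

/-! ### Syntax -/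

/-- Terms of a given sort, with variables from the context `Γ`. -/
inductive Term (L : Signature.{u}) (Γ : List L.Sorts) : L.Sorts → Type u
  | var (i : Fin Γ.length) : Term L Γ (Γ.get i)
  | app (f : L.Func) (args : ∀ i : Fin (L.dom f).length, Term L Γ ((L.dom f).get i)) :
      Term L Γ (L.cod f)

/-- Formulas of continuous logic, with free variables from the context `Γ`. The connectives are all
continuous functions `[0,1]ⁿ → [0,1]`, the quantifiers are `sup` and `inf`. -/
inductive Formula (L : Signature.{u}) : List L.Sorts → Type u
  | dist {Γ : List L.Sorts} {a : L.Sorts} (t₁ t₂ : Term L Γ a) : Formula L Γ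
  | pred {Γ : List L.Sorts} (P : L.Pred)
      (args : ∀ i : Fin (L.arity P).length, Term L Γ ((L.arity P).get i)) : Formula L Γ
  | conn {Γ : List L.Sorts} {n : ℕ} (c : C(Fin n → unitInterval, unitInterval))
      (φ : Fin n → Formula L Γ) : Formula L Γ
  | sup {Γ : List L.Sorts} (a : L.Sorts) (φ : Formula L (a :: Γ)) : Formula L Γ
  | inf {Γ : List L.Sorts} (a : L.Sorts) (φ : Formula L (a :: Γ)) : Formula L Γ

/-- A sentence is a formula without free variables. -/
abbrev Sentence (L : Signature.{u}) : Type u := Formula L []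

/-! ### Semantics -/

noncomputable section

variable {L : Signature.{u}}

/-- The value of a term. -/
def Term.eval (M : L.Structure) {Γ : List L.Sorts} (e : Env M.carrier Γ) :
    {a : L.Sorts} → Term L Γ a → M.carrier a
  | _, .var i => e i
  | _, .app f args => M.func f (fun i => (args i).eval M e)

/-- The value of a formula, a number in `[0,1]`. -/
def Formula.eval (M : L.Structure) :
    {Γ : List L.Sorts} → Formula L Γ → Env M.carrier Γ → unitInterval
  | _, .dist t₁ t₂, e => ⟨Dist.dist (t₁.eval M e) (t₂.eval M e), dist_nonneg, M.dist_le_one _ _ _⟩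
  | _, .pred P args, e => M.pred P (fun i => (args i).eval M e)
  | _, .conn c φ, e => c (fun j => (φ j).eval M e)
  | _, .sup a φ, e => ⨆ x : M.carrier a, φ.eval M (Env.cons x e)
  | _, .inf a φ, e => ⨅ x : M.carrier a, φ.eval M (Env.cons x e)

/-- The value `σ^M` of a sentence in a structure. -/
def Sentence.value (σ : Sentence L) (M : L.Structure) : unitInterval :=
  Formula.eval M σ Env.nil

namespace Signature.Structure

/-- A structure is finite if each of its sorts is finite. -/
def IsFinite (M : L.Structure) : Prop := ∀ s, Finite (M.carrier s)

/-- A structure is compact if each of its sorts is compact. -/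
def IsCompact (M : L.Structure) : Prop := ∀ s, CompactSpace (M.carrier s)

/-- `M` is pseudofinite if `σ^M = 0` for every sentence `σ` such that `σ^A = 0` for all finite
structures `A`. -/
def Pseudofinite (M : Signature.Structure.{u, w} L) : Prop :=
  ∀ σ : Sentence L,
    (∀ A : Signature.Structure.{u, w} L, A.IsFinite → σ.value A = 0) → σ.value M = 0

/-- `M` is pseudocompact if `σ^M = 0` for every sentence `σ` such that `σ^A = 0` for all compact
structures `A`. -/
def Pseudocompact (M : Signature.Structure.{u, w} L) : Prop :=
  ∀ σ : Sentence L,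
    (∀ A : Signature.Structure.{u, w} L, A.IsCompact → σ.value A = 0) → σ.value M = 0

end Signature.Structure

/-! ### Moduli of uniform continuity of formulas, uniform over all structures -/

/-- The minimum of `1` and finitely many real numbers. -/
def minOne {n : ℕ} (f : Fin n → ℝ) : ℝ :=
  (Finset.univ : Finset (Option (Fin n))).inf' ⟨none, Finset.mem_univ _⟩ (fun o => o.elim 1 f)

theorem minOne_le {n : ℕ} (f : Fin n → ℝ) (i : Fin n) : minOne f ≤ f i :=
  Finset.inf'_le (fun o : Option (Fin n) => o.elim 1 f) (Finset.mem_univ (some i))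

theorem minOne_pos {n : ℕ} {f : Fin n → ℝ} (h : ∀ i, 0 < f i) : 0 < minOne f := by
  refine (Finset.lt_inf'_iff _).2 ?_
  rintro (_ | i) _
  · exact one_pos
  · exact h i

theorem exists_connMod {n : ℕ} (c : C(Fin n → unitInterval, unitInterval)) (ε : ℝ) :
    ∃ δ : ℝ, 0 < δ ∧ (0 < ε → ∀ v v', (∀ i, dist (v i) (v' i) ≤ δ) → dist (c v) (c v') ≤ ε) := by
  by_cases hε : 0 < ε
  · obtain ⟨δ, hδ, h⟩ := Metric.uniformContinuous_iff.1
      (CompactSpace.uniformContinuous_of_continuous c.continuous) ε hε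
    refine ⟨δ / 2, by positivity, fun _ v v' hv => (h ?_).le⟩
    exact lt_of_le_of_lt ((dist_pi_le_iff (by positivity)).2 hv) (by linarith)
  · exact ⟨1, one_pos, fun h => absurd h hε⟩

/-- A modulus of uniform continuity of a connective. -/
def connMod {n : ℕ} (c : C(Fin n → unitInterval, unitInterval)) (ε : ℝ) : ℝ :=
  (exists_connMod c ε).choose

/-- A modulus of uniform continuity of a term, computed from those of the signature. -/
def Term.modulus {Γ : List L.Sorts} : {a : L.Sorts} → Term L Γ a → ℝ → ℝ
  | _, .var _, ε => ε
  | _, .app f args, ε => minOne (fun i => (args i).modulus (L.funcMod f ε / 2))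

/-- A modulus of uniform continuity of a formula, computed from those of the signature. -/
def Formula.modulus : {Γ : List L.Sorts} → Formula L Γ → ℝ → ℝ
  | _, .dist t₁ t₂, ε => min (t₁.modulus (ε / 2)) (t₂.modulus (ε / 2))
  | _, .pred P args, ε => minOne (fun i => (args i).modulus (L.predMod P ε / 2))
  | _, .conn c φ, ε => minOne (fun j => (φ j).modulus (connMod c ε))
  | _, .sup _ φ, ε => φ.modulus ε
  | _, .inf _ φ, ε => φ.modulus ε

theorem Term.modulus_pos {Γ : List L.Sorts} {a : L.Sorts} (t : Term L Γ a) :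
    ∀ {ε : ℝ}, 0 < ε → 0 < t.modulus ε := by
  induction t with
  | var i => intro ε hε; exact hε
  | app f args ih =>
    intro ε hε
    exact minOne_pos fun i => ih i (half_pos (L.funcMod_pos f ε hε))

theorem Formula.modulus_pos {Γ : List L.Sorts} (φ : Formula L Γ) :
    ∀ {ε : ℝ}, 0 < ε → 0 < φ.modulus ε := by
  induction φ with
  | dist t₁ t₂ =>
    intro ε hε
    exact lt_min (t₁.modulus_pos (half_pos hε)) (t₂.modulus_pos (half_pos hε))
  | pred P args =>
    intro ε hε
    exact minOne_pos fun i => (args i).modulus_pos (half_pos (L.predMod_pos P ε hε))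
  | conn c φ ih =>
    intro ε hε
    exact minOne_pos fun j => ih j (exists_connMod c ε).choose_spec.1
  | sup a φ ih => exact ih
  | inf a φ ih => exact ih

theorem Term.dist_eval_le (M : L.Structure) {Γ : List L.Sorts} {a : L.Sorts} (t : Term L Γ a) :
    ∀ {ε : ℝ}, 0 < ε → ∀ {e e' : Env M.carrier Γ}, (∀ i, dist (e i) (e' i) < t.modulus ε) →
      dist (t.eval M e) (t.eval M e') ≤ ε := by
  induction t with
  | var i => intro ε hε e e' h; exact (h i).le
  | app f args ih =>
    intro ε hε e e' h
    have hp := L.funcMod_pos f ε hε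
    refine M.func_mod f ε hε _ _ fun i => lt_of_le_of_lt (ih i (half_pos hp) fun j => ?_)
      (half_lt_self hp)
    exact lt_of_lt_of_le (h j) (minOne_le _ i)

theorem iSup_le_add {ι : Sort*} {f g : ι → unitInterval} {ε : ℝ} (hε : 0 ≤ ε)
    (h : ∀ i, dist (f i) (g i) ≤ ε) :
    ((⨆ i, f i : unitInterval) : ℝ) ≤ ((⨆ i, g i : unitInterval) : ℝ) + ε := by
  by_cases h1 : 1 ≤ ((⨆ i, g i : unitInterval) : ℝ) + ε
  · exact (⨆ i, f i).2.2.trans h1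
  · push Not at h1
    let c : unitInterval := ⟨((⨆ i, g i : unitInterval) : ℝ) + ε,
      add_nonneg (⨆ i, g i).2.1 hε, h1.le⟩
    have : (⨆ i, f i) ≤ c := by
      refine iSup_le fun i => ?_
      have h2 : (g i : ℝ) ≤ ((⨆ i, g i : unitInterval) : ℝ) := le_iSup g i
      have h3 : (f i : ℝ) - g i ≤ ε := (le_abs_self _).trans (h i)
      show (f i : ℝ) ≤ ((⨆ i, g i : unitInterval) : ℝ) + ε
      linarith
    exact this

theorem le_iInf_add {ι : Sort*} {f g : ι → unitInterval} {ε : ℝ} (hε : 0 ≤ ε)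
    (h : ∀ i, dist (f i) (g i) ≤ ε) :
    ((⨅ i, g i : unitInterval) : ℝ) - ε ≤ ((⨅ i, f i : unitInterval) : ℝ) := by
  by_cases h1 : ((⨅ i, g i : unitInterval) : ℝ) - ε ≤ 0
  · exact h1.trans (⨅ i, f i).2.1
  · push Not at h1
    let c : unitInterval := ⟨((⨅ i, g i : unitInterval) : ℝ) - ε,
      h1.le, (sub_le_self _ hε).trans (⨅ i, g i).2.2⟩
    have : c ≤ (⨅ i, f i) := by
      refine le_iInf fun i => ?_
      have h2 : ((⨅ i, g i : unitInterval) : ℝ) ≤ (g i : ℝ) := iInf_le g i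
      have h3 : (g i : ℝ) - f i ≤ ε := by
        have := h i
        rw [dist_comm] at this
        exact (le_abs_self _).trans this
      show ((⨅ i, g i : unitInterval) : ℝ) - ε ≤ (f i : ℝ)
      linarith
    exact this

theorem dist_iSup_le {ι : Sort*} {f g : ι → unitInterval} {ε : ℝ} (hε : 0 ≤ ε)
    (h : ∀ i, dist (f i) (g i) ≤ ε) : dist (⨆ i, f i) (⨆ i, g i) ≤ ε := by
  have h1 := iSup_le_add hε h
  have h2 := iSup_le_add hε (f := g) (g := f) fun i => by rw [dist_comm]; exact h i
  exact abs_sub_le_iff.2 ⟨by linarith, by linarith⟩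

theorem dist_iInf_le {ι : Sort*} {f g : ι → unitInterval} {ε : ℝ} (hε : 0 ≤ ε)
    (h : ∀ i, dist (f i) (g i) ≤ ε) : dist (⨅ i, f i) (⨅ i, g i) ≤ ε := by
  have h1 := le_iInf_add hε h
  have h2 := le_iInf_add hε (f := g) (g := f) fun i => by rw [dist_comm]; exact h i
  exact abs_sub_le_iff.2 ⟨by linarith, by linarith⟩

theorem abs_dist_sub_dist_le {X : Type*} [PseudoMetricSpace X] (x x' y y' : X) :
    |dist x y - dist x' y'| ≤ dist x x' + dist y y' := by
  have h := dist_dist_dist_le x y x' y'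
  rwa [Real.dist_eq] at h

theorem Formula.dist_eval_le (M : L.Structure) {Γ : List L.Sorts} (φ : Formula L Γ) :
    ∀ {ε : ℝ}, 0 < ε → ∀ {e e' : Env M.carrier Γ},
      (∀ i, Dist.dist (e i) (e' i) < φ.modulus ε) →
      Dist.dist (φ.eval M e) (φ.eval M e') ≤ ε := by
  induction φ with
  | dist t₁ t₂ =>
    intro ε hε e e' h
    refine (abs_dist_sub_dist_le _ _ _ _).trans ?_
    have h1 := t₁.dist_eval_le M (half_pos hε) fun i => lt_of_lt_of_le (h i) (min_le_left _ _)
    have h2 := t₂.dist_eval_le M (half_pos hε) fun i => lt_of_lt_of_le (h i) (min_le_right _ _)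
    linarith
  | pred P args =>
    intro ε hε e e' h
    have hp := L.predMod_pos P ε hε
    refine M.pred_mod P ε hε _ _ fun i =>
      lt_of_le_of_lt ((args i).dist_eval_le M (half_pos hp) fun j => ?_) (half_lt_self hp)
    exact lt_of_lt_of_le (h j) (minOne_le _ i)
  | conn c φ ih =>
    intro ε hε e e' h
    have hc := (exists_connMod c ε).choose_spec
    refine hc.2 hε _ _ fun j => ih j hc.1 fun i => ?_
    exact lt_of_lt_of_le (h i) (minOne_le _ j)
  | sup a φ ih =>
    intro ε hε e e' h
    refine dist_iSup_le hε.le fun x => ih hε ?_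
    refine Env.cons_rel (R := fun s x y => Dist.dist x y < φ.modulus ε) ?_ h
    rw [dist_self]
    exact φ.modulus_pos hε
  | inf a φ ih =>
    intro ε hε e e' h
    refine dist_iInf_le hε.le fun x => ih hε ?_
    refine Env.cons_rel (R := fun s x y => Dist.dist x y < φ.modulus ε) ?_ h
    rw [dist_self]
    exact φ.modulus_pos hε

/-! ### Forced limits -/

/-- The forced sequence of `(aₙ)`: it starts at `a₀`, and its `(n+1)`-st term is the point within
`2⁻⁽ⁿ⁺¹⁾` of its `n`-th term that is closest to `aₙ₊₁`. -/
def forcedSeq (a : ℕ → unitInterval) : ℕ → ℝ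
  | 0 => a 0
  | n + 1 => max (forcedSeq a n - (1 / 2) ^ (n + 1))
      (min (forcedSeq a n + (1 / 2) ^ (n + 1)) (a (n + 1)))

theorem forcedSeq_mem (a : ℕ → unitInterval) (n : ℕ) : forcedSeq a n ∈ unitInterval := by
  induction n with
  | zero => exact (a 0).2
  | succ n ih =>
    have hp : (0 : ℝ) < (1 / 2) ^ (n + 1) := by positivity
    have h1 := (a (n + 1)).2
    refine ⟨le_max_of_le_right (le_min ?_ h1.1), max_le ?_ ((min_le_right _ _).trans h1.2)⟩
    · linarith [ih.1]
    · linarith [ih.2]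

theorem dist_forcedSeq_succ_le (a : ℕ → unitInterval) (n : ℕ) :
    dist (forcedSeq a n) (forcedSeq a (n + 1)) ≤ (1 / 2) * (1 / 2) ^ n := by
  have hp : (0 : ℝ) < (1 / 2) ^ (n + 1) := by positivity
  have h1 : forcedSeq a n - (1 / 2) ^ (n + 1) ≤ forcedSeq a (n + 1) := le_max_left _ _
  have h2 : forcedSeq a (n + 1) ≤ forcedSeq a n + (1 / 2) ^ (n + 1) :=
    max_le (by linarith) (min_le_left _ _)
  rw [← pow_succ']
  exact abs_sub_le_iff.2 ⟨by linarith, by linarith⟩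

theorem tendsto_forcedSeq (a : ℕ → unitInterval) :
    Filter.Tendsto (forcedSeq a) Filter.atTop (nhds (Filter.limUnder Filter.atTop (forcedSeq a))) :=
  CauchySeq.tendsto_limUnder (cauchySeq_of_le_geometric (1 / 2) (1 / 2) (by norm_num)
    (dist_forcedSeq_succ_le a))

/-- The forced limit of a sequence in `[0,1]`, i.e. the limit of its forced sequence. -/
def forcedLim (a : ℕ → unitInterval) : unitInterval :=
  ⟨Filter.limUnder Filter.atTop (forcedSeq a),
    isClosed_Icc.mem_of_tendsto (tendsto_forcedSeq a)
      (Filter.Eventually.of_forall (forcedSeq_mem a))⟩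

theorem dist_forcedSeq_forcedLim_le (a : ℕ → unitInterval) (n : ℕ) :
    |forcedSeq a n - forcedLim a| ≤ (1 / 2) ^ n := by
  have h := dist_le_of_le_geometric_of_tendsto (1 / 2) (1 / 2) (by norm_num)
    (dist_forcedSeq_succ_le a) (tendsto_forcedSeq a) n
  have h2 : (1 / 2 : ℝ) * (1 / 2) ^ n / (1 - 1 / 2) = (1 / 2) ^ n := by ring
  rw [h2] at h
  exact h

theorem abs_forcedSeq_sub_le {a b : ℕ → unitInterval} {ε : ℝ} {n : ℕ}
    (h : ∀ k ≤ n, dist (a k) (b k) ≤ ε) : |forcedSeq a n - forcedSeq b n| ≤ ε := by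
  induction n with
  | zero => exact h 0 le_rfl
  | succ n ih =>
    have h1 := abs_sub_le_iff.1 (ih fun k hk => h k (hk.trans n.le_succ))
    have h2 := abs_sub_le_iff.1 (show |(a (n + 1) : ℝ) - b (n + 1)| ≤ ε from h _ le_rfl)
    have key : ∀ x y p q r : ℝ, x ≤ y + ε → p ≤ q + ε →
        max (x - r) (min (x + r) p) ≤ max (y - r) (min (y + r) q) + ε := by
      intro x y p q r hxy hpq
      refine max_le ?_ ?_
      · have := le_max_left (y - r) (min (y + r) q)
        linarith
      · have h3 := le_max_right (y - r) (min (y + r) q)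
        have h4 : min (x + r) p ≤ min (y + r) q + ε := by
          rw [← min_add_add_right]
          exact min_le_min (by linarith) hpq
        linarith
    refine abs_sub_le_iff.2 ⟨?_, ?_⟩
    · have := key (forcedSeq a n) (forcedSeq b n) (a (n + 1)) (b (n + 1)) ((1 / 2) ^ (n + 1))
        (by linarith) (by linarith)
      simp only [forcedSeq]
      linarith
    · have := key (forcedSeq b n) (forcedSeq a n) (b (n + 1)) (a (n + 1)) ((1 / 2) ^ (n + 1))
        (by linarith) (by linarith)
      simp only [forcedSeq]
      linarith

/-! ### Definable predicates `ψ(x, Y)` -/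

/-- The concatenation of the blocks `Y 0, …, Y n` (latest block first). -/
def blocks {S : Type u} (Y : ℕ → List S) : ℕ → List S
  | 0 => Y 0
  | n + 1 => Y (n + 1) ++ blocks Y n

/-- The data of a definable predicate `ψ(x, Y) = ℱlim φₙ(x, yₙ)`. Here `x` is a finite tuple of
variables of sorts `X`; the parameter variables `Y` form the finite or countable tuple obtained by
putting together the finite blocks `Y 0, Y 1, …`; and `yₙ` is the truncation of `Y` consisting of
the blocks `Y 0, …, Y n`. -/
structure Imaginary (L : Signature.{u}) : Type u where
  X : List L.Sorts
  Y : ℕ → List L.Sorts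
  φ : ∀ n : ℕ, Formula L (blocks Y n ++ X)

namespace Imaginary

/-- The sorts of the truncation `yₙ`. -/
abbrev trunc (ψ : Imaginary L) (n : ℕ) : List L.Sorts := blocks ψ.Y n

/-- `ψ` is finitary if its tuple `Y` of parameter variables is finite. -/
def IsFinitary (ψ : Imaginary L) : Prop := ∃ N, ∀ n, N ≤ n → ψ.Y n = []

/-- Tuples of sort `Y` in `M`. -/
def Params (ψ : Imaginary L) (M : Signature.Structure.{u, w} L) : Type w :=
  ∀ n, Env M.carrier (ψ.Y n)

/-- The truncation of a tuple of sort `Y`. -/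
def Params.trunc {ψ : Imaginary L} {M : Signature.Structure.{u, w} L} (b : ψ.Params M) :
    ∀ n, Env M.carrier (ψ.trunc n)
  | 0 => b 0
  | n + 1 => Env.append (b (n + 1)) (Params.trunc b n)

variable (ψ : Imaginary L) (M : Signature.Structure.{u, w} L)

/-- The value `ψ(x, b)`. -/
def value (x : Env M.carrier ψ.X) (b : ψ.Params M) : unitInterval :=
  forcedLim fun n => (ψ.φ n).eval M (Env.append (b.trunc n) x)

end Imaginary

/-- The distance of two points of `[0,1]`, as a point of `[0,1]`. -/
def absDiff (s t : unitInterval) : unitInterval := ⟨dist s t, dist_nonneg, by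
  have hs := s.2
  have ht := t.2
  exact abs_sub_le_iff.2 ⟨by linarith [hs.2, ht.1], by linarith [ht.2, hs.1]⟩⟩

theorem dist_absDiff_le (s t s' t' : unitInterval) :
    dist (absDiff s t) (absDiff s' t') ≤ dist s s' + dist t t' :=
  abs_dist_sub_dist_le s s' t t'

namespace Imaginary

variable (ψ : Imaginary L) (M : Signature.Structure.{u, w} L)

/-- The pseudometric `d(b, b') = sup_x |ψ(x, b) - ψ(x, b')|` on tuples of sort `Y`. -/
instance : PseudoMetricSpace (ψ.Params M) where
  dist b b' := ((⨆ x, absDiff (ψ.value M x b) (ψ.value M x b') : unitInterval) : ℝ)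
  dist_self b := by
    have : (⨆ x, absDiff (ψ.value M x b) (ψ.value M x b)) = 0 := by
      refine le_antisymm (iSup_le fun x => ?_) bot_le
      show dist _ _ ≤ (0 : ℝ)
      rw [dist_self]
    rw [this]
    rfl
  dist_comm b b' := by
    have : ∀ x, absDiff (ψ.value M x b) (ψ.value M x b') =
        absDiff (ψ.value M x b') (ψ.value M x b) := fun x => Subtype.ext (dist_comm _ _)
    simp only [this]
  dist_triangle b b' b'' := by
    by_cases h1 : 1 ≤ ((⨆ x, absDiff (ψ.value M x b) (ψ.value M x b') : unitInterval) : ℝ) +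
        ((⨆ x, absDiff (ψ.value M x b') (ψ.value M x b'') : unitInterval) : ℝ)
    · exact (Subtype.property _ : _ ∈ Set.Icc (0 : ℝ) 1).2.trans h1
    · push Not at h1
      set s : unitInterval := ⨆ x, absDiff (ψ.value M x b) (ψ.value M x b')
      set t : unitInterval := ⨆ x, absDiff (ψ.value M x b') (ψ.value M x b'')
      let c : unitInterval := ⟨(s : ℝ) + t, add_nonneg s.2.1 t.2.1, h1.le⟩
      have : (⨆ x, absDiff (ψ.value M x b) (ψ.value M x b'')) ≤ c := by
        refine iSup_le fun x => ?_
        have h2 : dist (ψ.value M x b) (ψ.value M x b') ≤ (s : ℝ) :=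
          le_iSup (fun x => absDiff (ψ.value M x b) (ψ.value M x b')) x
        have h3 : dist (ψ.value M x b') (ψ.value M x b'') ≤ (t : ℝ) :=
          le_iSup (fun x => absDiff (ψ.value M x b') (ψ.value M x b'')) x
        show dist _ _ ≤ (s : ℝ) + t
        exact (dist_triangle _ _ _).trans (add_le_add h2 h3)
      exact this

theorem dist_params (b b' : ψ.Params M) :
    dist b b' = ((⨆ x, absDiff (ψ.value M x b) (ψ.value M x b') : unitInterval) : ℝ) := rfl

/-- The imaginary sort `S_ψ`: the quotient of the tuples of sort `Y` by `d(b, b') = 0`, completed.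
The class `[b]_ψ` is the image of `b` under the canonical map into the completion. -/
abbrev Sort' : Type w := UniformSpace.Completion (ψ.Params M)

/-- The predicate `P_ψ(x, z)`, the continuous extension of `P_ψ(x, [b]_ψ) = ψ(x, b)`. -/
def P (x : Env M.carrier ψ.X) (z : ψ.Sort' M) : unitInterval :=
  UniformSpace.Completion.extension (ψ.value M x) z

/-- The predicate `γ_{ψ,n}(yₙ, z) = sup_x |φₙ(x, yₙ) - P_ψ(x, z)|`. -/
def γ (n : ℕ) (y : Env M.carrier (ψ.trunc n)) (z : ψ.Sort' M) : unitInterval :=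
  ⨆ x, absDiff ((ψ.φ n).eval M (Env.append y x)) (ψ.P M x z)

theorem dist_value_le (x : Env M.carrier ψ.X) (b b' : ψ.Params M) :
    dist (ψ.value M x b) (ψ.value M x b') ≤ dist b b' :=
  le_iSup (fun x => absDiff (ψ.value M x b) (ψ.value M x b')) x

theorem uniformContinuous_value (x : Env M.carrier ψ.X) : UniformContinuous (ψ.value M x) :=
  LipschitzWith.uniformContinuous (K := 1)
    (LipschitzWith.of_dist_le_mul fun b b' => by simpa using ψ.dist_value_le M x b b')

theorem P_coe (x : Env M.carrier ψ.X) (b : ψ.Params M) : ψ.P M x b = ψ.value M x b :=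
  UniformSpace.Completion.extension_coe (ψ.uniformContinuous_value M x) b

theorem continuous_P (x : Env M.carrier ψ.X) : Continuous (ψ.P M x) :=
  UniformSpace.Completion.continuous_extension

theorem dist_P_le (x : Env M.carrier ψ.X) (z z' : ψ.Sort' M) :
    dist (ψ.P M x z) (ψ.P M x z') ≤ dist z z' := by
  refine UniformSpace.Completion.induction_on₂ z z' ?_ fun b b' => ?_
  · exact isClosed_le (((ψ.continuous_P M x).comp continuous_fst).dist
      ((ψ.continuous_P M x).comp continuous_snd)) (continuous_fst.dist continuous_snd)
  · rw [P_coe, P_coe, UniformSpace.Completion.dist_eq]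
    exact ψ.dist_value_le M x b b'

theorem dist_sort_le_one (z z' : ψ.Sort' M) : dist z z' ≤ 1 := by
  refine UniformSpace.Completion.induction_on₂ z z' ?_ fun b b' => ?_
  · exact isClosed_le (continuous_fst.dist continuous_snd) continuous_const
  · rw [UniformSpace.Completion.dist_eq, dist_params]
    exact (Subtype.property _ : _ ∈ Set.Icc (0 : ℝ) 1).2

/-- A number `N` with `2⁻ᴺ ≤ ε / 4` if `0 < ε`. -/
def level (ε : ℝ) : ℕ := ⌈4 / ε⌉₊

theorem level_spec {ε : ℝ} (hε : 0 < ε) : (1 / 2 : ℝ) ^ level ε ≤ ε / 4 := by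
  have h1 : (4 / ε : ℝ) ≤ level ε := Nat.le_ceil _
  have h2 : ((level ε : ℕ) : ℝ) ≤ (2 : ℝ) ^ level ε := by
    exact_mod_cast (Nat.lt_two_pow_self).le
  have h3 : (4 / ε : ℝ) ≤ 2 ^ level ε := h1.trans h2
  have hp : (0 : ℝ) < 2 ^ level ε := by positivity
  rw [one_div, inv_pow, inv_le_comm₀ hp (by positivity)]
  rwa [inv_div]

/-- A modulus of uniform continuity of `ψ(x, Y)` in `x`, computed from those of the `φₙ`. -/
def modulus (ε : ℝ) : ℝ :=
  minOne (fun n : Fin (level ε + 1) => (ψ.φ n).modulus (ε / 2))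

theorem modulus_pos {ε : ℝ} (hε : 0 < ε) : 0 < ψ.modulus ε :=
  minOne_pos fun n => (ψ.φ n).modulus_pos (half_pos hε)

theorem dist_value_le_of_modulus {ε : ℝ} (hε : 0 < ε) {x x' : Env M.carrier ψ.X}
    (h : ∀ i, dist (x i) (x' i) < ψ.modulus ε) (b : ψ.Params M) :
    dist (ψ.value M x b) (ψ.value M x' b) ≤ ε := by
  have key : ∀ k ≤ level ε, dist ((ψ.φ k).eval M (Env.append (b.trunc k) x))
      ((ψ.φ k).eval M (Env.append (b.trunc k) x')) ≤ ε / 2 := by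
    intro k hk
    refine (ψ.φ k).dist_eval_le M (half_pos hε) ?_
    refine Env.append_rel (R := fun s x y => dist x y < (ψ.φ k).modulus (ε / 2)) ?_ fun i => ?_
    · intro i
      rw [dist_self]
      exact (ψ.φ k).modulus_pos (half_pos hε)
    · exact lt_of_lt_of_le (h i)
        (minOne_le (fun n : Fin (level ε + 1) => (ψ.φ n).modulus (ε / 2))
          ⟨k, Nat.lt_succ_of_le hk⟩)
  have h0 := abs_sub_le_iff.1 (abs_forcedSeq_sub_le key)
  have h1 := abs_sub_le_iff.1 (dist_forcedSeq_forcedLim_le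
    (fun n => (ψ.φ n).eval M (Env.append (b.trunc n) x)) (level ε))
  have h2 := abs_sub_le_iff.1 (dist_forcedSeq_forcedLim_le
    (fun n => (ψ.φ n).eval M (Env.append (b.trunc n) x')) (level ε))
  have h3 := level_spec hε
  show |(ψ.value M x b : ℝ) - ψ.value M x' b| ≤ ε
  unfold value
  exact abs_sub_le_iff.2 ⟨by linarith, by linarith⟩

theorem dist_P_le_of_modulus {ε : ℝ} (hε : 0 < ε) {x x' : Env M.carrier ψ.X}
    (h : ∀ i, dist (x i) (x' i) < ψ.modulus ε) (z : ψ.Sort' M) :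
    dist (ψ.P M x z) (ψ.P M x' z) ≤ ε := by
  refine UniformSpace.Completion.induction_on z ?_ fun b => ?_
  · exact isClosed_le ((ψ.continuous_P M x).dist (ψ.continuous_P M x')) continuous_const
  · rw [P_coe, P_coe]
    exact ψ.dist_value_le_of_modulus M hε h b

end Imaginary

/-! ### The eq expansion -/

/-- The predicate symbols of the eq expansion by the imaginary sorts in `J`. -/
inductive EqPred (L : Signature.{u}) (J : Set (Imaginary L)) : Type u
  | base (P : L.Pred) : EqPred L J
  | P (ψ : J) : EqPred L J
  | γ (ψ : J) (n : ℕ) : EqPred L J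

/-- The expansion of the signature `L` by, for each `ψ ∈ J`, the sort `S_ψ`, the predicate symbol
`P_ψ(x, z)` and the predicate symbols `γ_{ψ,n}(yₙ, z)`, where `z` is of sort `S_ψ` (the variable `z`
is listed first). -/
def Signature.eqOn (L : Signature.{u}) (J : Set (Imaginary L)) : Signature.{u} where
  Sorts := L.Sorts ⊕ J
  Func := L.Func
  Pred := EqPred L J
  dom f := (L.dom f).map Sum.inl
  cod f := Sum.inl (L.cod f)
  arity
    | .base P => (L.arity P).map Sum.inl
    | .P ψ => Sum.inr ψ :: ψ.1.X.map Sum.inl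
    | .γ ψ n => Sum.inr ψ :: (ψ.1.trunc n).map Sum.inl
  funcMod := L.funcMod
  predMod
    | .base P, ε => L.predMod P ε
    | .P ψ, ε => min (ε / 2) (ψ.1.modulus (ε / 2))
    | .γ ψ n, ε => min (ε / 2) ((ψ.1.φ n).modulus (ε / 2))
  funcMod_pos := L.funcMod_pos
  predMod_pos
    | .base P, ε, hε => L.predMod_pos P ε hε
    | .P ψ, _, hε => lt_min (half_pos hε) (ψ.1.modulus_pos (half_pos hε))
    | .γ ψ n, _, hε => lt_min (half_pos hε) ((ψ.1.φ n).modulus_pos (half_pos hε))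

namespace Signature.Structure

variable (M : Signature.Structure.{u, w} L) (J : Set (Imaginary L))

/-- The universes of the sorts of the eq expansion of `M` by the imaginary sorts in `J`. -/
abbrev eqCarrier : L.Sorts ⊕ J → Type w
  | .inl s => M.carrier s
  | .inr ψ => ψ.1.Sort' M

instance eqMetric : ∀ s, MetricSpace (M.eqCarrier J s)
  | .inl s => M.metric s
  | .inr ψ => (inferInstance : MetricSpace (ψ.1.Sort' M))

variable {J}

/-- The interpretation of `P_ψ`, as a function of the tuple `(z, x)`. -/
def eqP (ψ : J) (e : Env (M.eqCarrier J) (Sum.inr ψ :: ψ.1.X.map Sum.inl)) : unitInterval :=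
  ψ.1.P M (Env.unmap Sum.inl (Env.tail e)) (Env.head (M := M.eqCarrier J) e)

/-- The interpretation of `γ_{ψ,n}`, as a function of the tuple `(z, yₙ)`. -/
def eqγ (ψ : J) (n : ℕ) (e : Env (M.eqCarrier J) (Sum.inr ψ :: (ψ.1.trunc n).map Sum.inl)) :
    unitInterval :=
  ψ.1.γ M n (Env.unmap Sum.inl (Env.tail e)) (Env.head (M := M.eqCarrier J) e)

theorem eqP_mod (ψ : J) {ε : ℝ} (hε : 0 < ε)
    (e e' : Env (M.eqCarrier J) (Sum.inr ψ :: ψ.1.X.map Sum.inl))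
    (h : ∀ i, dist (e i) (e' i) < min (ε / 2) (ψ.1.modulus (ε / 2))) :
    dist (M.eqP ψ e) (M.eqP ψ e') ≤ ε := by
  have h0 : dist (Env.head (M := M.eqCarrier J) e) (Env.head (M := M.eqCarrier J) e') < ε / 2 := lt_of_lt_of_le (h 0) (min_le_left _ _)
  have h1 := Env.unmap_rel Sum.inl (N := M.eqCarrier J) (e := Env.tail e) (e' := Env.tail e')
    (R := fun (s : L.Sorts ⊕ J) (x y : M.eqCarrier J s) => dist x y < ψ.1.modulus (ε / 2))
    (fun i => lt_of_lt_of_le (h i.succ) (min_le_right _ _))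
  have h2 := ψ.1.dist_P_le_of_modulus M (half_pos hε) h1 (Env.head (M := M.eqCarrier J) e)
  have h3 := (ψ.1.dist_P_le M (Env.unmap Sum.inl (Env.tail e')) (Env.head (M := M.eqCarrier J) e)
    (Env.head (M := M.eqCarrier J) e')).trans h0.le
  refine (dist_triangle _ _ _).trans ((add_le_add h2 h3).trans ?_)
  linarith

theorem eqγ_mod (ψ : J) (n : ℕ) {ε : ℝ} (hε : 0 < ε)
    (e e' : Env (M.eqCarrier J) (Sum.inr ψ :: (ψ.1.trunc n).map Sum.inl))
    (h : ∀ i, dist (e i) (e' i) < min (ε / 2) ((ψ.1.φ n).modulus (ε / 2))) :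
    dist (M.eqγ ψ n e) (M.eqγ ψ n e') ≤ ε := by
  have h0 : dist (Env.head (M := M.eqCarrier J) e) (Env.head (M := M.eqCarrier J) e') < ε / 2 := lt_of_lt_of_le (h 0) (min_le_left _ _)
  have h1 := Env.unmap_rel Sum.inl (N := M.eqCarrier J) (e := Env.tail e) (e' := Env.tail e')
    (R := fun (s : L.Sorts ⊕ J) (x y : M.eqCarrier J s) =>
      dist x y < (ψ.1.φ n).modulus (ε / 2))
    (fun i => lt_of_lt_of_le (h i.succ) (min_le_right _ _))
  unfold eqγ Imaginary.γ
  refine dist_iSup_le hε.le fun x => ?_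
  refine (dist_absDiff_le _ _ _ _).trans ?_
  have h2 : dist ((ψ.1.φ n).eval M (Env.append (Env.unmap Sum.inl (Env.tail e)) x))
      ((ψ.1.φ n).eval M (Env.append (Env.unmap Sum.inl (Env.tail e')) x)) ≤ ε / 2 := by
    refine (ψ.1.φ n).dist_eval_le M (half_pos hε) ?_
    refine Env.append_rel (R := fun s x y => dist x y < (ψ.1.φ n).modulus (ε / 2)) h1 ?_
    intro i
    rw [dist_self]
    exact (ψ.1.φ n).modulus_pos (half_pos hε)
  have h3 := (ψ.1.dist_P_le M x (Env.head (M := M.eqCarrier J) e) (Env.head (M := M.eqCarrier J) e')).trans h0.le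
  linarith

variable (J)

/-- The eq expansion of the `L`-structure `M` by the imaginary sorts in `J`. -/
def eqOn : Signature.Structure.{u, w} (L.eqOn J) where
  carrier := M.eqCarrier J
  metric := M.eqMetric J
  complete
    | .inl s => M.complete s
    | .inr ψ => (inferInstance : CompleteSpace (ψ.1.Sort' M))
  nonempty
    | .inl s => M.nonempty s
    | .inr ψ => ⟨UniformSpace.Completion.coe'
        (show ψ.1.Params M from fun _ _ => Classical.choice (M.nonempty _))⟩
  dist_le_one
    | .inl s => M.dist_le_one s
    | .inr ψ => ψ.1.dist_sort_le_one M
  func f e := M.func f (Env.unmap Sum.inl e)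
  pred
    | .base P, e => M.pred P (Env.unmap Sum.inl e)
    | .P ψ, e => M.eqP ψ e
    | .γ ψ n, e => M.eqγ ψ n e
  func_mod f ε hε e e' h := M.func_mod f ε hε (Env.unmap Sum.inl e) (Env.unmap Sum.inl e') <|
    Env.unmap_rel Sum.inl (R := fun (s : L.Sorts ⊕ J) (x y : M.eqCarrier J s) =>
      dist x y < L.funcMod f ε) h
  pred_mod
    | .base P, ε, hε, e, e', h => M.pred_mod P ε hε (Env.unmap Sum.inl e) (Env.unmap Sum.inl e') <|
        Env.unmap_rel Sum.inl (R := fun (s : L.Sorts ⊕ J) (x y : M.eqCarrier J s) =>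
          dist x y < L.predMod P ε) h
    | .P ψ, _, hε, e, e', h => M.eqP_mod ψ hε e e' h
    | .γ ψ n, _, hε, e, e', h => M.eqγ_mod ψ n hε e e' h

end Signature.Structure

/-- The signature `L^eq`: a sort is added for every definable predicate `ψ(x, Y)`. -/
abbrev Signature.eq (L : Signature.{u}) : Signature.{u} := L.eqOn Set.univ

/-- The `L^eq`-structure `M^eq`. -/
abbrev Signature.Structure.eq (M : Signature.Structure.{u, w} L) :
    Signature.Structure.{u, w} L.eq := M.eqOn Set.univ

/-- The part of `L^eq` in which only sorts for finitary `ψ(x, y)` are added. -/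
abbrev Signature.eqFin (L : Signature.{u}) : Signature.{u} :=
  L.eqOn {ψ | ψ.IsFinitary}

/-- The modified eq expansion, by canonical parameters of finitary definable predicates only. -/
abbrev Signature.Structure.eqFin (M : Signature.Structure.{u, w} L) :
    Signature.Structure.{u, w} L.eqFin := M.eqOn {ψ | ψ.IsFinitary}

end

end ContLogic

-- The expansion adds nothing that formulas of `L` cannot see approximately: for every sentence σ of
-- the expanded signature and every ε > 0 there is an `L`-sentence τ whose value in any
-- `L`-structure is within ε of the value of σ in its expansion (`Sentence.exists_approximation`).
-- To see this, formulas are evaluated on representatives, a point of `S_ψ` being replaced by a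
-- tuple of sort `Y`. Forced limits converge at the rate 2⁻ⁿ in every structure, so up to ε each
-- atomic formula is an `L`-formula in a finite truncation of the representatives
-- (`approximable_dist`, `approximable_pred`). Quantifiers over `S_ψ` become quantifiers over
-- representatives by density, and then over finite tuples because truncation is surjective
-- (`Formula.approximable_eq`).
--
-- A compact `A` has a compact expansion: each `S_ψ` is a continuous image of a countable product of
-- compact sorts (`Imaginary.compactSpace_sort`). If σ vanishes in all compact structures, it
-- vanishes in the expansions of compact `A`, so the truncated difference of τ and the error
-- vanishes in compact `A`, hence in a pseudocompact `M`, and σ is small in the expansion of `M`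
-- (`Sentence.value_eqOn_eq_zero`).
--
-- For finite `A` the expansion may be infinite when `Y` is, but it is compact. Its functions take
-- values in the finite home sorts only, so finite nets containing those sorts entirely are
-- substructures, and the values of σ in ever denser ones converge to its value in the expansion
-- (`Sentence.value_eq_zero_of_isCompact`).

universe v

namespace ContLogic

/-! ### Tuples under sortwise maps -/

namespace Env

variable {S : Type u} {M : S → Type w} {N : S → Type v}

/-- Apply a family of functions to the entries of a tuple. -/
def map (f : ∀ s, M s → N s) {Γ : List S} (e : Env M Γ) : Env N Γ := fun i => f _ (e i)

theorem cons_head_tail {a : S} {Γ : List S} (e : Env M (a :: Γ)) : cons (head e) (tail e) = e := by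
  funext i
  exact Fin.cases rfl (fun _ => rfl) i

theorem eq_nil (e : Env M []) : e = nil := funext fun i => Fin.elim0 i

theorem map_cons (f : ∀ s, M s → N s) {a : S} {Γ : List S} (x : M a) (e : Env M Γ) :
    map f (cons x e) = cons (f a x) (map f e) := by
  funext i
  exact Fin.cases rfl (fun _ => rfl) i

theorem map_append (f : ∀ s, M s → N s) : ∀ {Γ Δ : List S} (e : Env M Γ) (e' : Env M Δ),
    map f (append e e') = append (map f e) (map f e')
  | [], _, _, _ => rfl
  | _ :: _, _, e, e' =>
    (map_cons f _ _).trans (congrArg (cons _) (map_append f (tail e) e'))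

theorem unmap_map {T : Type u} (g : S → T) {M : T → Type w} {N : T → Type v}
    (f : ∀ t, M t → N t) : ∀ {Γ : List S} (e : Env M (Γ.map g)),
    unmap g (map f e) = map (fun s => f (g s)) (unmap g e)
  | [], _ => (eq_nil (M := fun s => N (g s)) (map (fun s => f (g s)) nil)).symm
  | _ :: _, e => by
    have h := unmap_map g f (tail (M := M) e)
    refine Eq.trans ?_ (map_cons (M := fun s => M (g s)) (N := fun s => N (g s))
      (fun s => f (g s)) _ _).symm
    exact congrArg _ h

end Env

noncomputable section

variable {L : Signature.{u}}

/-! ### Substitution -/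

/-- Simultaneous substitution of terms for the variables of a term. -/
def Term.subst {Γ Δ : List L.Sorts} (σ : Env (Term L Δ) Γ) : {a : L.Sorts} → Term L Γ a → Term L Δ a
  | _, .var i => σ i
  | _, .app f args => .app f (fun i => (args i).subst σ)

/-- The values of a tuple of terms. -/
def evalTerms (M : Signature.Structure.{u, w} L) {Γ Δ : List L.Sorts} (σ : Env (Term L Δ) Γ)
    (e : Env M.carrier Δ) : Env M.carrier Γ :=
  Env.map (fun _ t => t.eval M e) σ

theorem Term.eval_subst (M : Signature.Structure.{u, w} L) {Γ Δ : List L.Sorts}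
    (σ : Env (Term L Δ) Γ) (e : Env M.carrier Δ) {a : L.Sorts} (t : Term L Γ a) :
    (t.subst σ).eval M e = t.eval M (evalTerms M σ e) := by
  induction t with
  | var i => rfl
  | app f args ih =>
    show M.func f _ = M.func f _
    exact congrArg _ (funext ih)

/-- The variables of a context, as terms in the context with one more variable in front. -/
def shift (Γ : List L.Sorts) (a : L.Sorts) : Env (Term L (a :: Γ)) Γ :=
  fun i => Term.var (Γ := a :: Γ) i.succ

/-- The first variable of a context. -/
def firstVar (Γ : List L.Sorts) (a : L.Sorts) : Term L (a :: Γ) a :=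
  Term.var (Γ := a :: Γ) ⟨0, Nat.succ_pos _⟩

/-- Composition of substitutions. -/
def compTerms {Γ Δ Θ : List L.Sorts} (σ : Env (Term L Δ) Γ) (τ : Env (Term L Θ) Δ) :
    Env (Term L Θ) Γ :=
  Env.map (fun _ t => t.subst τ) σ

/-- A substitution extended by a bound variable. -/
def liftTerms {Γ Δ : List L.Sorts} (a : L.Sorts) (σ : Env (Term L Δ) Γ) :
    Env (Term L (a :: Δ)) (a :: Γ) :=
  Env.cons (firstVar Δ a) (compTerms σ (shift Δ a))

theorem evalTerms_cons (M : Signature.Structure.{u, w} L) {Γ Δ : List L.Sorts} {a : L.Sorts}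
    (t : Term L Δ a) (σ : Env (Term L Δ) Γ) (e : Env M.carrier Δ) :
    evalTerms M (Env.cons t σ) e = Env.cons (t.eval M e) (evalTerms M σ e) :=
  Env.map_cons _ _ _

theorem evalTerms_append (M : Signature.Structure.{u, w} L) {Γ Γ' Δ : List L.Sorts}
    (σ : Env (Term L Δ) Γ) (τ : Env (Term L Δ) Γ') (e : Env M.carrier Δ) :
    evalTerms M (Env.append σ τ) e = Env.append (evalTerms M σ e) (evalTerms M τ e) :=
  Env.map_append _ _ _

theorem evalTerms_compTerms (M : Signature.Structure.{u, w} L) {Γ Δ Θ : List L.Sorts}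
    (σ : Env (Term L Δ) Γ) (τ : Env (Term L Θ) Δ) (e : Env M.carrier Θ) :
    evalTerms M (compTerms σ τ) e = evalTerms M σ (evalTerms M τ e) :=
  funext fun i => (σ i).eval_subst M τ e

theorem evalTerms_shift (M : Signature.Structure.{u, w} L) {Γ : List L.Sorts} {a : L.Sorts}
    (x : M.carrier a) (e : Env M.carrier Γ) : evalTerms M (shift Γ a) (Env.cons x e) = e := rfl

theorem evalTerms_liftTerms (M : Signature.Structure.{u, w} L) {Γ Δ : List L.Sorts} {a : L.Sorts}
    (σ : Env (Term L Δ) Γ) (x : M.carrier a) (e : Env M.carrier Δ) :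
    evalTerms M (liftTerms a σ) (Env.cons x e) = Env.cons x (evalTerms M σ e) := by
  rw [liftTerms, evalTerms_cons, evalTerms_compTerms, evalTerms_shift]
  rfl

/-- Simultaneous substitution of terms for the free variables of a formula. -/
def Formula.subst : {Γ Δ : List L.Sorts} → Env (Term L Δ) Γ → Formula L Γ → Formula L Δ
  | _, _, σ, .dist t₁ t₂ => .dist (t₁.subst σ) (t₂.subst σ)
  | _, _, σ, .pred P args => .pred P (fun i => (args i).subst σ)
  | _, _, σ, .conn c φ => .conn c (fun j => (φ j).subst σ)
  | _, _, σ, .sup a φ => .sup a (φ.subst (liftTerms a σ))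
  | _, _, σ, .inf a φ => .inf a (φ.subst (liftTerms a σ))

/-- The target context and the substitution vary inside the induction, since passing under a
quantifier lengthens the one and lifts the other. -/
theorem Formula.eval_subst (M : Signature.Structure.{u, w} L) {Γ : List L.Sorts} (φ : Formula L Γ) :
    ∀ {Δ : List L.Sorts} (σ : Env (Term L Δ) Γ) (e : Env M.carrier Δ),
      (φ.subst σ).eval M e = φ.eval M (evalTerms M σ e) := by
  induction φ with
  | dist t₁ t₂ =>
    intro Δ σ e
    apply Subtype.ext
    show Dist.dist _ _ = Dist.dist _ _
    rw [Term.eval_subst, Term.eval_subst]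
  | pred P args =>
    intro Δ σ e
    show M.pred P _ = M.pred P _
    exact congrArg _ (funext fun i => (args i).eval_subst M σ e)
  | conn c φ ih =>
    intro Δ σ e
    show c _ = c _
    exact congrArg _ (funext fun j => ih j σ e)
  | sup a φ ih =>
    intro Δ σ e
    show (⨆ x, _) = ⨆ x, _
    exact iSup_congr fun x => by rw [ih, evalTerms_liftTerms]
  | inf a φ ih =>
    intro Δ σ e
    show (⨅ x, _) = ⨅ x, _
    exact iInf_congr fun x => by rw [ih, evalTerms_liftTerms]

/-- The variables of the left part of a concatenated context. -/
def leftVars : ∀ Γ Δ : List L.Sorts, Env (Term L (Γ ++ Δ)) Γ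
  | [], _ => Env.nil
  | a :: Γ, Δ => liftTerms a (leftVars Γ Δ)

/-- The variables of the right part of a concatenated context. -/
def rightVars : ∀ Γ Δ : List L.Sorts, Env (Term L (Γ ++ Δ)) Δ
  | [], _ => Term.var
  | a :: Γ, Δ => compTerms (rightVars Γ Δ) (shift (Γ ++ Δ) a)

theorem evalTerms_leftVars (M : Signature.Structure.{u, w} L) : ∀ {Γ Δ : List L.Sorts}
    (e : Env M.carrier Γ) (e' : Env M.carrier Δ),
    evalTerms M (leftVars Γ Δ) (Env.append e e') = e
  | [], _, _, _ => (Env.eq_nil _).trans (Env.eq_nil _).symm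
  | a :: Γ, Δ, e, e' => by
    have h := evalTerms_leftVars M (Env.tail e) e'
    refine (evalTerms_liftTerms M (leftVars Γ Δ) (Env.head e)
      (Env.append (Env.tail e) e')).trans ?_
    rw [h, Env.cons_head_tail]

theorem evalTerms_rightVars (M : Signature.Structure.{u, w} L) : ∀ {Γ Δ : List L.Sorts}
    (e : Env M.carrier Γ) (e' : Env M.carrier Δ),
    evalTerms M (rightVars Γ Δ) (Env.append e e') = e'
  | [], _, _, _ => rfl
  | a :: Γ, Δ, e, e' => by
    refine (evalTerms_compTerms M (rightVars Γ Δ) (shift (Γ ++ Δ) a)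
      (Env.cons (Env.head e) (Env.append (Env.tail e) e'))).trans ?_
    rw [evalTerms_shift, evalTerms_rightVars M (Env.tail e) e']

/-- The supremum over a finite tuple of variables. -/
def Formula.supBlock : ∀ (X : List L.Sorts) {Δ : List L.Sorts}, Formula L (X ++ Δ) → Formula L Δ
  | [], _, φ => φ
  | a :: X, _, φ => Formula.supBlock X (.sup a φ)

theorem Formula.eval_supBlock (M : Signature.Structure.{u, w} L) : ∀ (X : List L.Sorts)
    {Δ : List L.Sorts} (φ : Formula L (X ++ Δ)) (e : Env M.carrier Δ),
    (φ.supBlock X).eval M e = ⨆ x : Env M.carrier X, φ.eval M (Env.append x e)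
  | [], Δ, φ, e => (ciSup_const (ι := Env M.carrier []) (hι := ⟨Env.nil⟩) (a := φ.eval M e)).symm
  | a :: X, Δ, φ, e => by
    rw [Formula.supBlock, Formula.eval_supBlock M X]
    refine le_antisymm (iSup_le fun x => iSup_le fun y => ?_) (iSup_le fun x => ?_)
    · exact le_iSup (fun x : Env M.carrier (a :: X) => φ.eval M (Env.append x e)) (Env.cons y x)
    · exact le_trans
        (le_iSup (fun y => φ.eval M (Env.cons y (Env.append (Env.tail x) e))) (Env.head x))
        (le_iSup (fun x => (Formula.sup a φ).eval M (Env.append x e)) (Env.tail x))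

/-! ### Uniform approximation by formulas -/

/-- A sequence of ways of reading an object attached to a structure as a finite tuple of elements
of that structure. -/
structure View (L : Signature.{u}) (A : Signature.Structure.{u, w} L → Type v) where
  ctx : ℕ → List L.Sorts
  proj : ∀ n M, A M → Env M.carrier (ctx n)

namespace View

variable {A : Signature.Structure.{u, w} L → Type v} (V : View L A)

/-- The tuple `p` is given by terms in all sufficiently fine readings. -/
def Expressible {Δ : List L.Sorts} (p : ∀ M, A M → Env M.carrier Δ) : Prop :=
  ∃ N, ∀ n, N ≤ n → ∃ σ : Env (Term L (V.ctx n)) Δ, ∀ M a, p M a = evalTerms M σ (V.proj n M a)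

/-- The `[0,1]`-valued function `F` is, uniformly in all structures, a limit of formulas in
sufficiently fine readings. -/
def Approximable (F : ∀ M, A M → unitInterval) : Prop :=
  ∀ ε : ℝ, 0 < ε → ∃ N, ∀ n, N ≤ n → ∃ φ : Formula L (V.ctx n),
    ∀ M a, dist (φ.eval M (V.proj n M a)) (F M a) ≤ ε

variable {V}

/-- Asking for all readings from some index on, not for one, is what lets two tuples be read in a
common context. -/
theorem Expressible.append {Δ Δ' : List L.Sorts} {p : ∀ M, A M → Env M.carrier Δ}
    {p' : ∀ M, A M → Env M.carrier Δ'} (h : V.Expressible p) (h' : V.Expressible p') :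
    V.Expressible fun M a => Env.append (p M a) (p' M a) := by
  obtain ⟨N, h⟩ := h
  obtain ⟨N', h'⟩ := h'
  refine ⟨max N N', fun n hn => ?_⟩
  obtain ⟨σ, hσ⟩ := h n (le_trans (le_max_left _ _) hn)
  obtain ⟨σ', hσ'⟩ := h' n (le_trans (le_max_right _ _) hn)
  exact ⟨Env.append σ σ', fun M a => by rw [evalTerms_append, ← hσ, ← hσ']⟩

theorem Expressible.approximable {Δ : List L.Sorts} {p : ∀ M, A M → Env M.carrier Δ}
    (h : V.Expressible p) (φ : Formula L Δ) : V.Approximable fun M a => φ.eval M (p M a) := by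
  intro ε hε
  obtain ⟨N, h⟩ := h
  refine ⟨N, fun n hn => ?_⟩
  obtain ⟨σ, hσ⟩ := h n hn
  refine ⟨φ.subst σ, fun M a => ?_⟩
  rw [Formula.eval_subst, ← hσ, dist_self]
  exact hε.le

/-- Closure under uniform limits, needed because a forced limit is not a connective of finitely many
arguments. -/
theorem Approximable.of_limit {F : ∀ M, A M → unitInterval}
    (h : ∀ ε : ℝ, 0 < ε → ∃ G : ∀ M, A M → unitInterval, V.Approximable G ∧
      ∀ M a, dist (G M a) (F M a) ≤ ε) : V.Approximable F := by
  intro ε hε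
  obtain ⟨G, hG, hGF⟩ := h (ε / 2) (half_pos hε)
  obtain ⟨N, hN⟩ := hG (ε / 2) (half_pos hε)
  refine ⟨N, fun n hn => ?_⟩
  obtain ⟨φ, hφ⟩ := hN n hn
  refine ⟨φ, fun M a => (dist_triangle _ (G M a) _).trans ?_⟩
  linarith [hφ M a, hGF M a]

theorem Approximable.conn {n : ℕ} (c : C(Fin n → unitInterval, unitInterval))
    {F : Fin n → ∀ M, A M → unitInterval} (h : ∀ j, V.Approximable (F j)) :
    V.Approximable fun M a => c fun j => F j M a := by
  intro ε hε
  have hc := (exists_connMod c ε).choose_spec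
  choose N hN using fun j => h j _ hc.1
  -- Beyond the largest of the finitely many thresholds all arguments are formulas in the same
  -- reading.
  refine ⟨Finset.univ.sup N, fun m hm => ?_⟩
  choose φ hφ using fun j => hN j m (le_trans (Finset.le_sup (Finset.mem_univ j)) hm)
  exact ⟨.conn c φ, fun M a => hc.2 hε _ _ fun j => hφ j M a⟩

theorem Approximable.map (c : C(unitInterval, unitInterval))
    {F : ∀ M, A M → unitInterval} (h : V.Approximable F) : V.Approximable fun M a => c (F M a) :=
  Approximable.conn (n := 1) ⟨fun v => c (v 0), by fun_prop⟩ (F := fun _ => F) fun _ => h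

theorem continuous_absDiff : Continuous fun p : unitInterval × unitInterval => absDiff p.1 p.2 :=
  Continuous.subtype_mk (continuous_fst.dist continuous_snd) _

theorem Approximable.absDiff {F G : ∀ M, A M → unitInterval} (hF : V.Approximable F)
    (hG : V.Approximable G) : V.Approximable fun M a => absDiff (F M a) (G M a) := by
  refine Approximable.conn (n := 2) ⟨fun v => ContLogic.absDiff (v 0) (v 1), ?_⟩
    (F := ![F, G]) ?_
  · exact continuous_absDiff.comp (f := fun v : Fin 2 → unitInterval => (v 0, v 1))
      ((continuous_apply 0).prodMk (continuous_apply 1))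
  · intro j
    fin_cases j
    · exact hF
    · exact hG

end View

/-! ### Forced limits of approximable functions -/

theorem continuous_forcedSeq {T : Type*} [TopologicalSpace T] {a : T → ℕ → unitInterval}
    (h : ∀ k, Continuous fun t => a t k) (n : ℕ) : Continuous fun t => forcedSeq (a t) n := by
  induction n with
  | zero => exact continuous_subtype_val.comp (h 0)
  | succ n ih =>
    exact (ih.sub continuous_const).max
      ((ih.add continuous_const).min (continuous_subtype_val.comp (h (n + 1))))

/-- The case ε = 0 of the Lipschitz estimate `abs_forcedSeq_sub_le`. -/
theorem forcedSeq_congr {a b : ℕ → unitInterval} {n : ℕ} (h : ∀ k ≤ n, a k = b k) :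
    forcedSeq a n = forcedSeq b n := by
  have := abs_forcedSeq_sub_le (a := a) (b := b) (ε := 0) (n := n)
    fun k hk => by rw [h k hk, dist_self]
  exact sub_eq_zero.1 (abs_nonpos_iff.1 this)

/-- The `n`-th term of the forced sequence, as a connective applied to the first `n + 1` terms. -/
def forcedConn (n : ℕ) : C(Fin (n + 1) → unitInterval, unitInterval) where
  toFun v := ⟨forcedSeq (fun k => v (Fin.ofNat (n + 1) k)) n, forcedSeq_mem _ _⟩
  continuous_toFun := Continuous.subtype_mk
    (continuous_forcedSeq (fun k => continuous_apply (Fin.ofNat (n + 1) k)) n) _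

theorem forcedConn_apply (a : ℕ → unitInterval) (n : ℕ) :
    (forcedConn n (fun k => a k) : ℝ) = forcedSeq a n :=
  forcedSeq_congr fun k hk => by
    -- `Fin.ofNat` wraps indices modulo n + 1, which has no effect on the indices up to n that
    -- matter.
    show a (k % (n + 1)) = a k
    rw [Nat.mod_eq_of_lt (Nat.lt_succ_of_le hk)]

/-- The n-th forced term is a connective of finitely many entries, and its distance 2⁻ⁿ from the
limit depends neither on the structure nor on the sequence. This uniformity is the point of forced
limits. -/
theorem View.Approximable.forcedLim {A : Signature.Structure.{u, w} L → Type v} {V : View L A}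
    {F : ℕ → ∀ M, A M → unitInterval} (h : ∀ n, V.Approximable (F n)) :
    V.Approximable fun M a => forcedLim fun n => F n M a := by
  refine View.Approximable.of_limit fun ε hε => ?_
  obtain ⟨n, hn⟩ := exists_pow_lt_of_lt_one hε (show (1 / 2 : ℝ) < 1 by norm_num)
  refine ⟨fun M a => forcedConn n fun k => F k M a,
    View.Approximable.conn (forcedConn n) fun k => h k, fun M a => ?_⟩
  show |(forcedConn n (fun k => F k M a) : ℝ) - ContLogic.forcedLim fun n => F n M a| ≤ ε
  rw [forcedConn_apply fun k => F k M a]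
  exact (dist_forcedSeq_forcedLim_le _ n).trans hn.le

/-! ### Representatives of the elements of the eq expansion -/

namespace Signature.Structure

variable (M : Signature.Structure.{u, w} L) (J : Set (Imaginary L))

/-- Representatives of the elements of the sorts of the eq expansion: the representatives of the
elements of `S_ψ` are the tuples of sort `Y`. -/
def Rep : L.Sorts ⊕ J → Type w
  | .inl s => M.carrier s
  | .inr ψ => ψ.1.Params M

variable {M J}

/-- The element with a given representative. -/
def Rep.cls : ∀ {a : L.Sorts ⊕ J}, M.Rep J a → M.eqCarrier J a
  | .inl _, x => x
  | .inr ψ, b => UniformSpace.Completion.coe' (show ψ.1.Params M from b)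

theorem Rep.denseRange_cls (a : L.Sorts ⊕ J) : DenseRange (Rep.cls (M := M) (a := a)) :=
  match a with
  | .inl _ => Function.surjective_id.denseRange
  | .inr ψ => UniformSpace.Completion.denseRange_coe (α := ψ.1.Params M)

end Signature.Structure

open Signature.Structure (Rep)

variable {J : Set (Imaginary L)}

/-- The sorts of the `n`-th truncation of a representative. -/
def truncSorts (n : ℕ) : L.Sorts ⊕ J → List L.Sorts
  | .inl s => [s]
  | .inr ψ => ψ.1.trunc n

/-- The sorts of the `n`-th truncation of a tuple of representatives. -/
def truncCtx (n : ℕ) : List (L.Sorts ⊕ J) → List L.Sorts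
  | [] => []
  | a :: Γ => truncSorts n a ++ truncCtx n Γ

/-- The `n`-th truncation of a representative. -/
def truncRep {M : Signature.Structure.{u, w} L} (n : ℕ) :
    ∀ {a : L.Sorts ⊕ J}, M.Rep J a → Env M.carrier (truncSorts n a)
  | .inl _, x => Env.cons x Env.nil
  | .inr _, b => Imaginary.Params.trunc b n

/-- The `n`-th truncation of a tuple of representatives. -/
def truncEnv {M : Signature.Structure.{u, w} L} (n : ℕ) :
    ∀ {Γ : List (L.Sorts ⊕ J)}, Env (M.Rep J) Γ → Env M.carrier (truncCtx n Γ)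
  | [], _ => Env.nil
  | _ :: _, ρ => Env.append (truncRep n (Env.head ρ)) (truncEnv n (Env.tail ρ))

/-! ### Surjectivity and compatibility of truncations -/

theorem Env.exists_append {S : Type u} {M : S → Type w} : ∀ {Γ Δ : List S} (e : Env M (Γ ++ Δ)),
    ∃ (e₁ : Env M Γ) (e₂ : Env M Δ), Env.append e₁ e₂ = e
  | [], _, e => ⟨Env.nil, e, rfl⟩
  | a :: Γ, Δ, e => by
    obtain ⟨e₁, e₂, h⟩ := Env.exists_append (Γ := Γ) (Δ := Δ) (Env.tail (a := a) e)
    refine ⟨Env.cons (Env.head (a := a) (Γ := Γ ++ Δ) e) e₁, e₂, ?_⟩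
    refine Eq.trans ?_ (Env.cons_head_tail (a := a) (Γ := Γ ++ Δ) e)
    exact congrArg (Env.cons (Env.head (a := a) (Γ := Γ ++ Δ) e)) h

theorem Imaginary.Params.exists_trunc_eq {ψ : Imaginary L} {M : Signature.Structure.{u, w} L}
    (n : ℕ) (y : Env M.carrier (ψ.trunc n)) : ∃ b : ψ.Params M, b.trunc n = y := by
  -- The strengthened claim survives the induction: changing block n + 1 must not disturb the n-th
  -- truncation.
  suffices h : ∃ b : ψ.Params M, ∀ b' : ψ.Params M, (∀ k ≤ n, b' k = b k) → b'.trunc n = y by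
    obtain ⟨b, hb⟩ := h
    exact ⟨b, hb b fun _ _ => rfl⟩
  induction n with
  | zero =>
    classical
    -- Entries outside the truncation are arbitrary; they exist because sorts are nonempty.
    refine ⟨Function.update (fun _ _ => Classical.choice (M.nonempty _)) 0 y, fun b' h => ?_⟩
    exact (h 0 le_rfl).trans (Function.update_self _ _ _)
  | succ n ih =>
    classical
    obtain ⟨y₁, y₂, rfl⟩ := Env.exists_append (Γ := ψ.Y (n + 1)) (Δ := ψ.trunc n) y
    obtain ⟨b, hb⟩ := ih y₂
    refine ⟨Function.update b (n + 1) y₁, fun b' h => ?_⟩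
    have h1 : b' (n + 1) = y₁ := (h (n + 1) le_rfl).trans (Function.update_self _ _ _)
    have h2 : b'.trunc n = y₂ := hb b' fun k hk =>
      (h k (hk.trans n.le_succ)).trans (Function.update_of_ne (by omega) _ _)
    rw [Imaginary.Params.trunc, h1, h2]

theorem truncRep_surjective (M : Signature.Structure.{u, w} L) (n : ℕ) (a : L.Sorts ⊕ J) :
    Function.Surjective (truncRep (M := M) n (a := a)) :=
  match a with
  | .inl s => fun y => ⟨Env.head (M := M.carrier) (a := s) (Γ := []) y,
      (congrArg (Env.cons (Env.head (a := s) (Γ := []) y)) (Env.eq_nil _).symm).trans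
        (Env.cons_head_tail (a := s) (Γ := []) y)⟩
  | .inr _ => fun y => Imaginary.Params.exists_trunc_eq n y

/-- The newest block stands first, so each truncation is the right part of the next one and is read
off by variables, the same ones in every structure. -/
theorem exists_terms_trunc (ψ : Imaginary L) (k n : ℕ) (h : k ≤ n) :
    ∃ σ : Env (Term L (ψ.trunc n)) (ψ.trunc k), ∀ (M : Signature.Structure.{u, w} L)
      (b : ψ.Params M), b.trunc k = evalTerms M σ (b.trunc n) := by
  induction n, h using Nat.le_induction with
  | base => exact ⟨Term.var, fun _ _ => rfl⟩
  | succ n _ ih =>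
    obtain ⟨σ, hσ⟩ := ih
    refine ⟨compTerms σ (rightVars (ψ.Y (n + 1)) (ψ.trunc n)), fun M b => ?_⟩
    refine (hσ M b).trans (Eq.trans ?_ (evalTerms_compTerms M σ _ _).symm)
    exact congrArg _ (evalTerms_rightVars M (b (n + 1)) (b.trunc n)).symm

/-- The terms of the eq expansion, evaluated on representatives. -/
def Term.rep (M : Signature.Structure.{u, w} L) {Γ : List (L.Sorts ⊕ J)} (ρ : Env (M.Rep J) Γ) :
    {a : L.Sorts ⊕ J} → Term (L.eqOn J) Γ a → M.Rep J a
  | _, .var i => ρ i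
  | _, .app f args => M.func f (Env.unmap (N := M.Rep J) Sum.inl fun i => (args i).rep M ρ)

/-- The tuple with given representatives. -/
def clsEnv {M : Signature.Structure.{u, w} L} {Γ : List (L.Sorts ⊕ J)} (ρ : Env (M.Rep J) Γ) :
    Env (M.eqOn J).carrier Γ :=
  Env.map (fun _ => Rep.cls) ρ

theorem unmap_clsEnv {M : Signature.Structure.{u, w} L} {Γ : List L.Sorts}
    (ρ : Env (M.Rep J) (Γ.map Sum.inl)) :
    Env.unmap Sum.inl (clsEnv ρ) = Env.unmap (N := M.Rep J) Sum.inl ρ :=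
  Env.unmap_map Sum.inl (fun _ => Rep.cls) ρ

/-- Function symbols have arguments and values in home sorts, where an element is its own
representative; hence terms can be computed before passing to classes. -/
theorem Term.cls_rep (M : Signature.Structure.{u, w} L) {Γ : List (L.eqOn J).Sorts}
    (ρ : Env (M.Rep J) Γ) {a : (L.eqOn J).Sorts} (t : Term (L.eqOn J) Γ a) :
    t.eval (M.eqOn J) (clsEnv ρ) = Rep.cls (t.rep M ρ) := by
  induction t with
  | var i => rfl
  | app f args ih =>
    have h : (fun i => (args i).eval (M.eqOn J) (clsEnv ρ)) = clsEnv fun i => (args i).rep M ρ :=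
      funext ih
    refine Eq.trans (congrArg
      (fun e => M.func f (Env.unmap (N := (M.eqOn J).carrier) Sum.inl e)) h) ?_
    exact congrArg (M.func f) (unmap_clsEnv _)

theorem exists_terms_var (n : ℕ) : ∀ (Γ : List (L.Sorts ⊕ J)) (i : Fin Γ.length),
    ∃ σ : Env (Term L (truncCtx n Γ)) (truncSorts n (Γ.get i)),
      ∀ (M : Signature.Structure.{u, w} L) (ρ : Env (M.Rep J) Γ),
        truncRep n (ρ i) = evalTerms M σ (truncEnv n ρ)
  | [], i => Fin.elim0 i
  | a :: Γ, i => by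
    refine Fin.cases ?_ (fun j => ?_) i
    · exact ⟨leftVars (truncSorts n a) (truncCtx n Γ), fun M ρ =>
        (evalTerms_leftVars M (truncRep n (Env.head ρ)) (truncEnv n (Env.tail ρ))).symm⟩
    · obtain ⟨σ, hσ⟩ := exists_terms_var n Γ j
      refine ⟨compTerms σ (rightVars (truncSorts n a) (truncCtx n Γ)), fun M ρ => ?_⟩
      refine (hσ M (Env.tail ρ)).trans (Eq.trans ?_ (evalTerms_compTerms M σ _ _).symm)
      exact congrArg _ (evalTerms_rightVars M (truncRep n (Env.head ρ)) (truncEnv n (Env.tail ρ))).symm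

/-- Stated for an arbitrary family of tuples, so that the recursion can pass to tails and the lemma
applies to the arguments of functions and predicates alike. -/
theorem exists_terms_unmap {Θ : List L.Sorts} (n : ℕ) {B : Signature.Structure.{u, w} L → Type v}
    (q : ∀ M, B M → Env M.carrier Θ) : ∀ (Δ : List L.Sorts)
    (r : ∀ M, B M → Env (M.Rep J) (Δ.map Sum.inl)),
    (∀ i, ∃ σ : Env (Term L Θ) (truncSorts n ((Δ.map (Sum.inl (β := J))).get i)),
      ∀ M a, truncRep n (r M a i) = evalTerms M σ (q M a)) →
    ∃ σ : Env (Term L Θ) Δ, ∀ M a,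
      Env.unmap (N := M.Rep J) Sum.inl (r M a) = evalTerms M σ (q M a)
  | [], _, _ => ⟨Env.nil, fun _ _ => (Env.eq_nil _).symm⟩
  | s :: Δ, r, h => by
    obtain ⟨σ, hσ⟩ := exists_terms_unmap n q Δ (fun M a => Env.tail (r M a)) fun i => h i.succ
    obtain ⟨τ, hτ⟩ := h ⟨0, Nat.succ_pos _⟩
    refine ⟨Env.cons (Env.head (a := s) (Γ := []) τ) σ, fun M a => ?_⟩
    rw [evalTerms_cons, ← hσ]
    have h0 : Env.head (r M a) = Term.eval M (q M a) (Env.head (a := s) (Γ := []) τ) :=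
      congrArg (fun e => Env.head (M := M.carrier) (a := s) (Γ := []) e) (hτ M a)
    rw [← h0]
    rfl

theorem Term.exists_terms_rep (n : ℕ) {Γ : List (L.eqOn J).Sorts} {a : (L.eqOn J).Sorts}
    (t : Term (L.eqOn J) Γ a) :
    ∃ σ : Env (Term L (truncCtx n Γ)) (truncSorts n a),
      ∀ (M : Signature.Structure.{u, w} L) (ρ : Env (M.Rep J) Γ),
        truncRep n (t.rep M ρ) = evalTerms M σ (truncEnv n ρ) := by
  induction t with
  | var i => exact exists_terms_var n Γ i
  | app f args ih =>
    obtain ⟨σ, hσ⟩ := exists_terms_unmap n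
      (B := fun M : Signature.Structure.{u, w} L => Env (M.Rep J) Γ) (fun M ρ => truncEnv n ρ)
      (L.dom f) (fun M ρ i => (args i).rep M ρ) ih
    refine ⟨Env.cons (Term.app (L := L) f σ) Env.nil, fun M ρ => ?_⟩
    refine Eq.trans ?_ (evalTerms_cons M (Term.app (L := L) f σ) Env.nil _).symm
    refine (congrArg (fun x => Env.cons x Env.nil) (congrArg (M.func f) (hσ M ρ))).trans ?_
    exact congrArg _ (Env.eq_nil _).symm

/-! ### Approximation of the formulas of the eq expansion -/

/-- Pairs of a tuple of elements of sorts `X` and a tuple of representatives, read by truncating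
the representatives. -/
def eqView (X : List L.Sorts) (Γ : List (L.Sorts ⊕ J)) :
    View L fun M : Signature.Structure.{u, w} L => Env M.carrier X × Env (M.Rep J) Γ where
  ctx n := X ++ truncCtx n Γ
  proj n _ a := Env.append a.1 (truncEnv n a.2)

variable {X : List L.Sorts} {Γ : List (L.Sorts ⊕ J)}

theorem expressible_fst : (eqView.{u, w} X Γ).Expressible fun _ a => a.1 :=
  ⟨0, fun n _ => ⟨leftVars X (truncCtx n Γ), fun M a =>
    (evalTerms_leftVars M a.1 (truncEnv n a.2)).symm⟩⟩

theorem expressible_snd {Δ : List L.Sorts}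
    {p : ∀ M : Signature.Structure.{u, w} L, Env (M.Rep J) Γ → Env M.carrier Δ} (N : ℕ)
    (h : ∀ n, N ≤ n → ∃ σ : Env (Term L (truncCtx n Γ)) Δ,
      ∀ M ρ, p M ρ = evalTerms M σ (truncEnv n ρ)) :
    (eqView X Γ).Expressible fun M a => p M a.2 := by
  refine ⟨N, fun n hn => ?_⟩
  obtain ⟨σ, hσ⟩ := h n hn
  refine ⟨compTerms σ (rightVars X (truncCtx n Γ)), fun M a => ?_⟩
  refine (hσ M a.2).trans (Eq.trans ?_ (evalTerms_compTerms M σ _ _).symm)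
  exact congrArg _ (evalTerms_rightVars M a.1 (truncEnv n a.2)).symm

theorem expressible_rep {s : L.Sorts} (t : Term (L.eqOn J) Γ (Sum.inl s)) :
    (eqView.{u, w} X Γ).Expressible fun M a =>
      (Env.cons (t.rep M a.2) Env.nil : Env M.carrier [s]) :=
  expressible_snd 0 fun n _ => t.exists_terms_rep n

/-- The k-th truncation is contained in every reading of index at least k, which gives the
threshold. -/
theorem expressible_trunc {ψ : J} (t : Term (L.eqOn J) Γ (Sum.inr ψ)) (k : ℕ) :
    (eqView.{u, w} X Γ).Expressible fun M a =>
      Imaginary.Params.trunc (ψ := ψ.1) (M := M) (t.rep M a.2) k :=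
  expressible_snd (p := fun M ρ => Imaginary.Params.trunc (ψ := ψ.1) (M := M) (t.rep M ρ) k) k
    fun n hn => by
      obtain ⟨σ, hσ⟩ := t.exists_terms_rep.{u, w} n
      obtain ⟨τ, hτ⟩ := exists_terms_trunc.{u, w} ψ.1 k n hn
      refine ⟨compTerms τ σ, fun M ρ => ?_⟩
      refine (hτ M (t.rep M ρ)).trans (Eq.trans ?_ (evalTerms_compTerms M τ σ _).symm)
      exact congrArg _ (hσ M ρ)

theorem expressible_args {Δ : List L.Sorts}
    (t : ∀ i : Fin (Δ.map (Sum.inl (β := J))).length,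
      Term (L.eqOn J) Γ ((Δ.map Sum.inl).get i)) :
    (eqView.{u, w} X Γ).Expressible fun M a =>
      Env.unmap (N := M.Rep J) Sum.inl fun i => (t i).rep M a.2 :=
  expressible_snd 0 fun n _ => exists_terms_unmap n
    (B := fun M : Signature.Structure.{u, w} L => Env (M.Rep J) Γ) (fun _ ρ => truncEnv n ρ)
    Δ (fun M ρ i => (t i).rep M ρ) fun i => (t i).exists_terms_rep n

/-- A forced limit of formulas, each of which involves one truncation of the parameter. -/
theorem approximable_value {ψ : J} (t : Term (L.eqOn J) Γ (Sum.inr ψ))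
    {x : ∀ M : Signature.Structure.{u, w} L,
      Env M.carrier X × Env (M.Rep J) Γ → Env M.carrier ψ.1.X}
    (hx : (eqView X Γ).Expressible x) :
    (eqView X Γ).Approximable fun M a => ψ.1.value M (x M a) (t.rep M a.2) :=
  View.Approximable.forcedLim fun n => ((expressible_trunc t n).append hx).approximable (ψ.1.φ n)

/-- This supremum over the auxiliary block is the one in the metric of `S_ψ` and in `γ`; taking
suprema does not increase a uniform error. -/
theorem View.Approximable.iSup_fst
    {F : ∀ M : Signature.Structure.{u, w} L, Env M.carrier X × Env (M.Rep J) Γ → unitInterval}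
    (h : (eqView X Γ).Approximable F) :
    (eqView [] Γ).Approximable fun M a => ⨆ x, F M (x, a.2) := by
  intro ε hε
  obtain ⟨N, hN⟩ := h ε hε
  refine ⟨N, fun n hn => ?_⟩
  obtain ⟨φ, hφ⟩ := hN n hn
  refine ⟨Formula.supBlock (Δ := truncCtx n Γ) X φ, fun M a => ?_⟩
  refine Eq.trans_le (congrArg (fun s => dist s _) (Formula.eval_supBlock M X φ _)) ?_
  exact dist_iSup_le hε.le fun x => hφ M (x, a.2)

/-- The approximating formula sees only a truncation of the possibly infinite representative. As
every finite tuple is a truncation, its supremum over representatives is one over finitely many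
variables. -/
theorem View.Approximable.iSup_rep {b : L.Sorts ⊕ J}
    {F : ∀ M : Signature.Structure.{u, w} L, Env (M.Rep J) (b :: Γ) → unitInterval}
    (h : (eqView [] (b :: Γ)).Approximable fun M a => F M a.2) :
    (eqView [] Γ).Approximable fun M a => ⨆ r : M.Rep J b, F M (Env.cons r a.2) := by
  intro ε hε
  obtain ⟨N, hN⟩ := h ε hε
  refine ⟨N, fun n hn => ?_⟩
  obtain ⟨φ, hφ⟩ := hN n hn
  refine ⟨Formula.supBlock (Δ := truncCtx n Γ) (truncSorts n b) φ, fun M a => ?_⟩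
  refine Eq.trans_le (congrArg (fun s => dist s _)
    ((Formula.eval_supBlock M (truncSorts n b) (Δ := truncCtx n Γ) φ (truncEnv n a.2)).trans
      (Function.Surjective.iSup_comp (truncRep_surjective M n b) _).symm)) ?_
  exact dist_iSup_le hε.le fun r => hφ M (Env.nil, Env.cons r a.2)

theorem iInf_eq_symm_iSup_symm {ι : Sort*} (f : ι → unitInterval) :
    ⨅ i, f i = unitInterval.symm (⨆ i, unitInterval.symm (f i)) := by
  refine le_antisymm ?_ (le_iInf fun i => ?_)
  · rw [unitInterval.le_symm_comm]
    exact iSup_le fun i => unitInterval.symm_le_symm.2 (iInf_le f i)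
  · rw [unitInterval.symm_le_comm]
    exact le_iSup (fun i => unitInterval.symm (f i)) i

theorem View.Approximable.iInf_rep {b : L.Sorts ⊕ J}
    {F : ∀ M : Signature.Structure.{u, w} L, Env (M.Rep J) (b :: Γ) → unitInterval}
    (h : (eqView [] (b :: Γ)).Approximable fun M a => F M a.2) :
    (eqView [] Γ).Approximable fun M a => ⨅ r : M.Rep J b, F M (Env.cons r a.2) := by
  have h1 := (View.Approximable.iSup_rep (F := fun M ρ => unitInterval.symm (F M ρ))
    (h.map ⟨unitInterval.symm, unitInterval.continuous_symm⟩)).map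
      ⟨unitInterval.symm, unitInterval.continuous_symm⟩
  refine cast (congrArg _ ?_) h1
  funext M a
  exact (iInf_eq_symm_iSup_symm _).symm

/-- Used with the classes of representatives, which are dense in `S_ψ` but need not exhaust it. -/
theorem DenseRange.iSup_comp {α Z : Type*} [TopologicalSpace Z] {i : α → Z} (hi : DenseRange i)
    {g : Z → unitInterval} (hg : Continuous g) : ⨆ z, g z = ⨆ b, g (i b) :=
  le_antisymm (iSup_le fun z => hi.induction_on z (isClosed_le hg continuous_const)
    fun b => le_iSup (fun b => g (i b)) b) (iSup_le fun b => le_iSup g (i b))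

theorem DenseRange.iInf_comp {α Z : Type*} [TopologicalSpace Z] {i : α → Z} (hi : DenseRange i)
    {g : Z → unitInterval} (hg : Continuous g) : ⨅ z, g z = ⨅ b, g (i b) :=
  le_antisymm (le_iInf fun b => iInf_le g (i b)) (le_iInf fun z => hi.induction_on z
    (isClosed_le continuous_const hg) fun b => iInf_le (fun b => g (i b)) b)

theorem Formula.continuous_eval_cons (N : Signature.Structure.{u, w} L) {Γ : List L.Sorts}
    {a : L.Sorts} (θ : Formula L (a :: Γ)) (e : Env N.carrier Γ) :
    Continuous fun z : N.carrier a => θ.eval N (Env.cons z e) := by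
  refine Metric.continuous_iff.2 fun z ε hε => ⟨θ.modulus (ε / 2), θ.modulus_pos (half_pos hε),
    fun z' hz => lt_of_le_of_lt (θ.dist_eval_le N (half_pos hε) ?_) (half_lt_self hε)⟩
  refine Env.cons_rel (R := fun s x y => Dist.dist x y < θ.modulus (ε / 2)) hz fun i => ?_
  rw [dist_self]
  exact θ.modulus_pos (half_pos hε)

theorem clsEnv_cons {M : Signature.Structure.{u, w} L} {a : L.Sorts ⊕ J} (r : M.Rep J a)
    (ρ : Env (M.Rep J) Γ) : clsEnv (Env.cons r ρ) = Env.cons (Rep.cls r) (clsEnv ρ) :=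
  Env.map_cons _ _ _

theorem approximable_dist {a : L.Sorts ⊕ J} (t₁ t₂ : Term (L.eqOn J) Γ a) :
    (eqView.{u, w} [] Γ).Approximable fun M ρ =>
      (Formula.dist (L := L.eqOn J) t₁ t₂).eval (M.eqOn J) (clsEnv ρ.2) := by
  rcases a with s | ψ
  · have h := ((expressible_rep.{u, w} (X := []) t₁).append (expressible_rep t₂)).approximable
      (.dist (Γ := [s, s]) (.var (Γ := [s, s]) 0) (.var (Γ := [s, s]) 1))
    refine cast (congrArg _ ?_) h
    funext M ρ
    refine Subtype.ext ?_
    exact (congrArg₂ (fun x y : M.carrier s => dist x y)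
      (t₁.cls_rep M ρ.2) (t₂.cls_rep M ρ.2)).symm
  -- On an imaginary sort the distance of two classes is the supremum over x of |ψ(x, b) - ψ(x,
  -- b')|.
  · have h := ((approximable_value.{u, w} (X := ψ.1.X) t₁ expressible_fst).absDiff
      (approximable_value t₂ expressible_fst)).iSup_fst
    refine cast (congrArg _ ?_) h
    funext M ρ
    refine Subtype.ext ?_
    refine Eq.trans ?_ (congrArg₂ (fun x y : ψ.1.Sort' M => dist x y)
      (t₁.cls_rep M ρ.2) (t₂.cls_rep M ρ.2)).symm
    exact (UniformSpace.Completion.dist_eq (α := ψ.1.Params M) (t₁.rep M ρ.2)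
      (t₂.rep M ρ.2)).symm

theorem approximable_pred (P : (L.eqOn J).Pred)
    (args : ∀ i : Fin ((L.eqOn J).arity P).length,
      Term (L.eqOn J) Γ (((L.eqOn J).arity P).get i)) :
    (eqView.{u, w} [] Γ).Approximable fun M ρ =>
      (Formula.pred P args).eval (M.eqOn J) (clsEnv ρ.2) := by
  have hargs : ∀ (M : Signature.Structure.{u, w} L) (ρ : Env (M.Rep J) Γ),
      (fun i => (args i).eval (M.eqOn J) (clsEnv ρ)) = clsEnv fun i => (args i).rep M ρ :=
    fun M ρ => funext fun i => (args i).cls_rep M ρ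
  rcases P with P | ψ | ⟨ψ, n⟩
  · have h := (expressible_args.{u, w} (X := []) (Δ := L.arity P) args).approximable
      (.pred (Γ := L.arity P) P Term.var)
    refine cast (congrArg _ ?_) h
    funext M ρ
    show _ = (M.eqOn J).pred (.base P) _
    rw [hargs]
    exact congrArg (M.pred P) (unmap_clsEnv _).symm
  -- The first argument is the imaginary one; on a class, `P_ψ` is the value of ψ at a
  -- representative.
  · have h := approximable_value.{u, w} (X := []) (args ⟨0, Nat.succ_pos _⟩)
      (expressible_args (Δ := ψ.1.X) fun i => args i.succ)
    refine cast (congrArg _ ?_) h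
    funext M ρ
    show _ = (M.eqOn J).pred (.P ψ) _
    rw [hargs]
    refine (ψ.1.P_coe M _ _).symm.trans ?_
    exact congrArg (fun x => ψ.1.P M x _) (unmap_clsEnv fun i => (args i.succ).rep M ρ.2).symm
  · have h := ((((expressible_args (Δ := ψ.1.trunc n) fun i => args i.succ).append
      (expressible_fst.{u, w} (X := ψ.1.X))).approximable (ψ.1.φ n)).absDiff
        (approximable_value (args ⟨0, Nat.succ_pos _⟩) expressible_fst)).iSup_fst
    refine cast (congrArg _ ?_) h
    funext M ρ
    show _ = (M.eqOn J).pred (.γ ψ n) _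
    rw [hargs]
    refine Eq.trans ?_ (congrArg (fun y => ψ.1.γ M n y _)
      (unmap_clsEnv fun i => (args i.succ).rep M ρ.2).symm)
    refine iSup_congr fun x => ?_
    exact congrArg _ (ψ.1.P_coe M _ _).symm

theorem Formula.approximable_eq {Γ : List (L.eqOn J).Sorts} (θ : Formula (L.eqOn J) Γ) :
    (eqView.{u, w} [] Γ).Approximable fun M ρ => θ.eval (M.eqOn J) (clsEnv ρ.2) := by
  induction θ with
  | dist t₁ t₂ => exact approximable_dist t₁ t₂
  | pred P args => exact approximable_pred P args
  | conn c φ ih => exact View.Approximable.conn c ih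
  | sup a θ ih =>
    refine cast (congrArg _ ?_) (View.Approximable.iSup_rep
      (F := fun M ρ => θ.eval (M.eqOn J) (clsEnv ρ)) ih)
    funext M ρ
    refine Eq.trans ?_ (DenseRange.iSup_comp (Z := (M.eqOn J).carrier a) (i := Rep.cls)
      (Rep.denseRange_cls a) (θ.continuous_eval_cons (M.eqOn J) (clsEnv ρ.2))).symm
    exact iSup_congr fun r => congrArg _ (clsEnv_cons r ρ.2)
  | inf a θ ih =>
    refine cast (congrArg _ ?_) (View.Approximable.iInf_rep
      (F := fun M ρ => θ.eval (M.eqOn J) (clsEnv ρ)) ih)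
    funext M ρ
    refine Eq.trans ?_ (DenseRange.iInf_comp (Z := (M.eqOn J).carrier a) (i := Rep.cls)
      (Rep.denseRange_cls a) (θ.continuous_eval_cons (M.eqOn J) (clsEnv ρ.2))).symm
    exact iInf_congr fun r => congrArg _ (clsEnv_cons r ρ.2)

/-- Every sentence of the eq expansion is, uniformly in all structures, a limit of sentences of the
original signature. -/
theorem Sentence.exists_approximation (σ : Sentence (L.eqOn J)) {ε : ℝ} (hε : 0 < ε) :
    ∃ τ : Sentence L, ∀ M : Signature.Structure.{u, w} L,
      dist (τ.value M) (σ.value (M.eqOn J)) ≤ ε := by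
  obtain ⟨N, h⟩ := Formula.approximable_eq.{u, w} σ ε hε
  obtain ⟨τ, hτ⟩ := h N le_rfl
  refine ⟨τ, fun M => ?_⟩
  have h1 := hτ M (Env.nil, Env.nil)
  have h2 : (clsEnv (Env.nil : Env (M.Rep J) [])) = Env.nil := Env.eq_nil _
  exact Eq.trans_le (congrArg (fun e => dist _ (Formula.eval (M.eqOn J) σ e)) h2.symm) h1

/-! ### Compactness and finiteness of the imaginary sorts -/

namespace Imaginary

variable (ψ : Imaginary L) (M : Signature.Structure.{u, w} L)

/-- The first terms, up to `level ε`, contribute ε/2, and each of the two forced tails beyond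
contributes at most ε/4. So up to ε the pseudometric depends on finitely many coordinates. -/
theorem dist_params_le {ε : ℝ} (hε : 0 < ε) {b b' : ψ.Params M}
    (h : ∀ k ≤ level ε, ∀ i, dist (b.trunc k i) (b'.trunc k i) < (ψ.φ k).modulus (ε / 2)) :
    dist b b' ≤ ε := by
  have hv : ∀ x, |(ψ.value M x b : ℝ) - ψ.value M x b'| ≤ ε := by
    intro x
    have key : ∀ k ≤ level ε, dist ((ψ.φ k).eval M (Env.append (b.trunc k) x))
        ((ψ.φ k).eval M (Env.append (b'.trunc k) x)) ≤ ε / 2 := by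
      intro k hk
      refine (ψ.φ k).dist_eval_le M (half_pos hε) ?_
      refine Env.append_rel (R := fun s x y => dist x y < (ψ.φ k).modulus (ε / 2)) (h k hk) ?_
      intro i
      rw [dist_self]
      exact (ψ.φ k).modulus_pos (half_pos hε)
    have h0 := abs_sub_le_iff.1 (abs_forcedSeq_sub_le key)
    have h1 := abs_sub_le_iff.1 (dist_forcedSeq_forcedLim_le
      (fun n => (ψ.φ n).eval M (Env.append (b.trunc n) x)) (level ε))
    have h2 := abs_sub_le_iff.1 (dist_forcedSeq_forcedLim_le
      (fun n => (ψ.φ n).eval M (Env.append (b'.trunc n) x)) (level ε))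
    have h3 := level_spec hε
    unfold value
    exact abs_sub_le_iff.2 ⟨by linarith, by linarith⟩
  -- Comparison with the supremum of the zero function turns the pointwise bound into one for the
  -- pseudometric.
  have h0 : dist (⨆ x, absDiff (ψ.value M x b) (ψ.value M x b'))
      (⨆ _ : Env M.carrier ψ.X, (0 : unitInterval)) ≤ ε := by
    refine dist_iSup_le hε.le fun x => ?_
    show |dist (ψ.value M x b) (ψ.value M x b') - 0| ≤ ε
    rw [sub_zero, abs_of_nonneg dist_nonneg]
    exact hv x
  have h1 : (⨆ _ : Env M.carrier ψ.X, (0 : unitInterval)) = 0 :=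
    le_antisymm (iSup_le fun _ => le_rfl) bot_le
  rw [h1] at h0
  have h2 := (le_abs_self _).trans h0
  rw [dist_params]
  simpa using h2

theorem eventually_dist_trunc_lt (b : ∀ n, Env M.carrier (ψ.Y n)) (k : ℕ) {δ : ℝ} (hδ : 0 < δ) :
    ∀ᶠ b' : ∀ n, Env M.carrier (ψ.Y n) in nhds b, ∀ i,
      dist (Params.trunc (ψ := ψ) (M := M) b' k i)
        (Params.trunc (ψ := ψ) (M := M) b k i) < δ := by
  have hblock : ∀ n, ∀ᶠ b' : ∀ n, Env M.carrier (ψ.Y n) in nhds b,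
      ∀ i, dist (b' n i) (b n i) < δ := fun n =>
    Filter.eventually_all.2 fun i => (((continuous_apply i).comp (continuous_apply n)).tendsto b)
      (Metric.ball_mem_nhds (b n i) hδ)
  induction k with
  | zero => exact hblock 0
  | succ k ih =>
    filter_upwards [hblock (k + 1), ih] with b' h1 h2
    exact Env.append_rel (R := fun s x y => dist x y < δ) h1 h2

/-- A family of tuples of sorts `Y 0, Y 1, …`, as a tuple of sort `Y`. -/
def toParams (b : ∀ n, Env M.carrier (ψ.Y n)) : ψ.Params M := b

/-- The underlying map is the identity; the content is that the product topology refines that of the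
pseudometric. -/
theorem continuous_toParams : Continuous (ψ.toParams M) := by
  refine continuous_iff_continuousAt.2 fun b => Metric.tendsto_nhds.2 fun ε hε => ?_
  have h : ∀ᶠ b' : ∀ n, Env M.carrier (ψ.Y n) in nhds b,
      ∀ k ∈ Finset.range (level (ε / 2) + 1), ∀ i,
        dist (Params.trunc (ψ := ψ) (M := M) b' k i)
          (Params.trunc (ψ := ψ) (M := M) b k i) < (ψ.φ k).modulus (ε / 2 / 2) :=
    (Filter.eventually_all_finset _).2 fun k _ =>
      ψ.eventually_dist_trunc_lt M b k ((ψ.φ k).modulus_pos (half_pos (half_pos hε)))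
  filter_upwards [h] with b' hb'
  refine lt_of_le_of_lt (ψ.dist_params_le M (half_pos hε) fun k hk => ?_) (half_lt_self hε)
  exact hb' k (Finset.mem_range.2 (Nat.lt_succ_of_le hk))

/-- By Tychonoff the tuples of sort `Y` form a compact product, whose image in the completion is
compact and dense. -/
theorem compactSpace_sort (h : M.IsCompact) : CompactSpace (ψ.Sort' M) := by
  have := fun s => (h s : CompactSpace (M.carrier s))
  have hc : Continuous fun b : ∀ n, Env M.carrier (ψ.Y n) =>
      (UniformSpace.Completion.coe' (ψ.toParams M b) : ψ.Sort' M) :=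
    (UniformSpace.Completion.continuous_coe _).comp (ψ.continuous_toParams M)
  have hd : DenseRange (UniformSpace.Completion.coe' : ψ.Params M → ψ.Sort' M) :=
    UniformSpace.Completion.denseRange_coe
  have hr := isCompact_range hc
  refine ⟨?_⟩
  rw [← hd.closure_range]
  exact hr.closure

theorem finite_sort (h : M.IsFinite) (hψ : ψ.IsFinitary) : Finite (ψ.Sort' M) := by
  have := fun s => (h s : Finite (M.carrier s))
  obtain ⟨N, hN⟩ := hψ
  have hf : Finite (ψ.Params M) := by
    refine Finite.of_injective
      (fun (b : ψ.Params M) (n : Fin N) => (b n : Env M.carrier (ψ.Y n))) fun b b' hb => ?_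
    funext n
    rcases lt_or_ge n N with hn | hn
    · exact congrFun hb ⟨n, hn⟩
    · funext i
      -- Blocks from `N` on are empty, so there is no coordinate left to compare.
      exact absurd (i.2.trans_eq (congrArg List.length (hN n hn))) (Nat.not_lt_zero _)
  have hd : DenseRange (UniformSpace.Completion.coe' : ψ.Params M → ψ.Sort' M) :=
    UniformSpace.Completion.denseRange_coe
  have hr := Set.finite_range (UniformSpace.Completion.coe' : ψ.Params M → ψ.Sort' M)
  rw [← Set.finite_univ_iff, ← hd.closure_range, hr.isClosed.closure_eq]
  exact hr

end Imaginary

namespace Signature.Structure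

theorem IsCompact.eqOn {M : Signature.Structure.{u, w} L} (h : M.IsCompact)
    (J : Set (Imaginary L)) : (M.eqOn J).IsCompact
  | .inl s => h s
  | .inr ψ => ψ.1.compactSpace_sort M h

theorem IsFinite.eqOn {M : Signature.Structure.{u, w} L} (h : M.IsFinite)
    {J : Set (Imaginary L)} (hJ : ∀ ψ ∈ J, ψ.IsFinitary) : (M.eqOn J).IsFinite
  | .inl s => h s
  | .inr ψ => ψ.1.finite_sort M h (hJ _ ψ.2)

theorem IsFinite.isCompact {M : Signature.Structure.{u, w} L} (h : M.IsFinite) : M.IsCompact :=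
  fun s => have : Finite (M.carrier s) := h s; inferInstance

/-! ### Substructures -/

/-- A choice of a nonempty complete subset of each sort, closed under the functions. -/
structure Subuniverse (N : Signature.Structure.{u, w} L) where
  carrier : ∀ s, Set (N.carrier s)
  nonempty : ∀ s, (carrier s).Nonempty
  complete : ∀ s, IsComplete (carrier s)
  func_mem : ∀ f (e : Env N.carrier (L.dom f)), (∀ i, e i ∈ carrier _) → N.func f e ∈ carrier _

namespace Subuniverse

variable {N : Signature.Structure.{u, w} L} (F : N.Subuniverse)

/-- The inclusion of tuples. -/
def incl {Γ : List L.Sorts} (e : Env (fun s => F.carrier s) Γ) : Env N.carrier Γ :=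
  Env.map (fun _ x => x.1) e

/-- The substructure with a given universe. -/
def toStructure : Signature.Structure.{u, w} L where
  carrier s := F.carrier s
  metric _ := inferInstance
  complete s := (F.complete s).completeSpace_coe
  nonempty s := (F.nonempty s).to_subtype
  dist_le_one s x y := N.dist_le_one s x.1 y.1
  func f e := ⟨N.func f (F.incl e), F.func_mem f _ fun i => (e i).2⟩
  pred P e := N.pred P (F.incl e)
  func_mod f ε hε e e' h := N.func_mod f ε hε (F.incl e) (F.incl e') h
  pred_mod P ε hε e e' h := N.pred_mod P ε hε (F.incl e) (F.incl e') h

theorem coe_eval_term {Γ : List L.Sorts} {a : L.Sorts} (t : Term L Γ a)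
    (e : Env F.toStructure.carrier Γ) :
    (t.eval F.toStructure e : F.carrier a).1 = t.eval N (F.incl e) := by
  induction t with
  | var i => rfl
  | app f args ih => exact congrArg (N.func f) (funext ih)

/-- Every element of every sort has distance less than `δ` from the subuniverse. -/
def IsDense (δ : ℝ) : Prop := ∀ s (x : N.carrier s), ∃ y ∈ F.carrier s, dist x y < δ

variable {F}

theorem IsDense.mono {δ δ' : ℝ} (h : F.IsDense δ) (hδ : δ ≤ δ') : F.IsDense δ' := fun s x => by
  obtain ⟨y, hy, hxy⟩ := h s x
  exact ⟨y, hy, hxy.trans_le hδ⟩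

/-- Points of the subuniverse are fixed and the others go to nearby points of it. Surjectivity lets
a quantifier over the substructure be reindexed over the whole structure. -/
theorem IsDense.exists_retraction {δ : ℝ} (hδ : 0 < δ) (h : F.IsDense δ) (s : L.Sorts) :
    ∃ r : N.carrier s → F.carrier s, Function.Surjective r ∧ ∀ x, dist (r x).1 x < δ := by
  have key : ∀ x : N.carrier s, ∃ y : F.carrier s, (x ∈ F.carrier s → y.1 = x) ∧
      dist y.1 x < δ := by
    intro x
    by_cases hx : x ∈ F.carrier s
    · exact ⟨⟨x, hx⟩, fun _ => rfl, by rwa [dist_self]⟩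
    · obtain ⟨y, hy, hxy⟩ := h s x
      exact ⟨⟨y, hy⟩, fun h => absurd h hx, by rwa [dist_comm]⟩
  choose r hr hd using key
  exact ⟨r, fun y => ⟨y.1, Subtype.ext (hr y.1 y.2)⟩, hd⟩

/-- Half of the error comes from passing to the substructure at the point `r x`, half from moving `r
x` to `x` by uniform continuity. -/
theorem IsDense.exists_retraction_eval {Γ : List L.Sorts} {a : L.Sorts}
    {θ : Formula L (a :: Γ)} {ε δ : ℝ} (hε : 0 < ε)
    (hθ : ∀ F : N.Subuniverse, F.IsDense δ → ∀ e : Env F.toStructure.carrier (a :: Γ),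
      dist (θ.eval F.toStructure e) (θ.eval N (F.incl e)) ≤ ε / 2)
    (h : F.IsDense (min δ (θ.modulus (ε / 2)))) (hδ : 0 < δ) (e : Env F.toStructure.carrier Γ) :
    ∃ r : N.carrier a → F.toStructure.carrier a, Function.Surjective r ∧ ∀ x,
      dist (θ.eval F.toStructure (Env.cons (r x) e)) (θ.eval N (Env.cons x (F.incl e))) ≤ ε := by
  obtain ⟨r, hr, hd⟩ :=
    h.exists_retraction (lt_min hδ (θ.modulus_pos (half_pos hε))) a
  refine ⟨r, hr, fun x => ?_⟩
  have h1 := hθ F (h.mono (min_le_left _ _)) (Env.cons (M := F.toStructure.carrier) (r x) e)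
  have h2 : F.incl (Env.cons (M := F.toStructure.carrier) (r x) e) =
      Env.cons (r x).1 (F.incl e) := Env.map_cons _ _ _
  rw [h2] at h1
  have h3 : dist (θ.eval N (Env.cons (r x).1 (F.incl e))) (θ.eval N (Env.cons x (F.incl e)))
      ≤ ε / 2 := by
    refine θ.dist_eval_le N (half_pos hε) ?_
    refine Env.cons_rel (R := fun s x y => dist x y < θ.modulus (ε / 2))
      ((hd x).trans_le (min_le_right _ _)) fun i => ?_
    rw [dist_self]
    exact θ.modulus_pos (half_pos hε)
  refine (dist_triangle _ _ _).trans ((add_le_add h1 h3).trans ?_)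
  linarith

end Subuniverse

end Signature.Structure

/-- The values of a formula in sufficiently dense substructures are close to its values in the
structure. -/
theorem Formula.exists_dist_eval_toStructure_le (N : Signature.Structure.{u, w} L)
    {Γ : List L.Sorts} (θ : Formula L Γ) : ∀ {ε : ℝ}, 0 < ε → ∃ δ : ℝ, 0 < δ ∧
      ∀ F : N.Subuniverse, F.IsDense δ → ∀ e : Env F.toStructure.carrier Γ,
        Dist.dist (θ.eval F.toStructure e) (θ.eval N (F.incl e)) ≤ ε := by
  induction θ with
  | dist t₁ t₂ =>
    -- Atomic formulas have the same value in every substructure, so any δ serves.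
    refine fun hε => ⟨1, one_pos, fun F _ e => ?_⟩
    have h : (Formula.dist t₁ t₂).eval F.toStructure e =
        (Formula.dist t₁ t₂).eval N (F.incl e) :=
      Subtype.ext (congrArg₂ Dist.dist (F.coe_eval_term t₁ e) (F.coe_eval_term t₂ e))
    rw [h, dist_self]
    exact hε.le
  | pred P args =>
    refine fun hε => ⟨1, one_pos, fun F _ e => ?_⟩
    have h : (Formula.pred P args).eval F.toStructure e =
        (Formula.pred P args).eval N (F.incl e) :=
      congrArg (N.pred P) (funext fun i => F.coe_eval_term (args i) e)
    rw [h, dist_self]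
    exact hε.le
  | conn c φ ih =>
    intro ε hε
    have hc := (exists_connMod c ε).choose_spec
    choose δ hδ h using fun j => ih j hc.1
    exact ⟨minOne δ, minOne_pos hδ, fun F hF e => hc.2 hε _ _ fun j =>
      h j F (hF.mono (minOne_le δ j)) e⟩
  | sup a θ ih =>
    intro ε hε
    obtain ⟨δ, hδ, h⟩ := ih (half_pos hε)
    refine ⟨_, lt_min hδ (θ.modulus_pos (half_pos hε)), fun F hF e => ?_⟩
    obtain ⟨r, hr, hd⟩ := hF.exists_retraction_eval hε h hδ e
    exact Eq.trans_le (congrArg (fun s => Dist.dist s _) (hr.iSup_comp _).symm)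
      (dist_iSup_le hε.le hd)
  | inf a θ ih =>
    intro ε hε
    obtain ⟨δ, hδ, h⟩ := ih (half_pos hε)
    refine ⟨_, lt_min hδ (θ.modulus_pos (half_pos hε)), fun F hF e => ?_⟩
    obtain ⟨r, hr, hd⟩ := hF.exists_retraction_eval hε h hδ e
    exact Eq.trans_le (congrArg (fun s => Dist.dist s _) (hr.iInf_comp _).symm)
      (dist_iInf_le hε.le hd)

/-- Taking the whole space when it is finite makes the nets closed under functions with values in
finite sorts. -/
theorem exists_finite_net {Z : Type*} [PseudoMetricSpace Z] [CompactSpace Z] {δ : ℝ} (hδ : 0 < δ) :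
    ∃ F : Set Z, F.Finite ∧ (Finite Z → F = Set.univ) ∧ ∀ x, ∃ y ∈ F, dist x y < δ := by
  by_cases h : Finite Z
  · exact ⟨Set.univ, Set.finite_univ, fun _ => rfl, fun x => ⟨x, trivial, by rwa [dist_self]⟩⟩
  · obtain ⟨F, -, hF, hc⟩ := (isCompact_univ (X := Z)).finite_cover_balls hδ
    refine ⟨F, hF, fun h' => absurd h' h, fun x => ?_⟩
    obtain ⟨y, hy, hxy⟩ := Set.mem_iUnion₂.1 (hc (Set.mem_univ x))
    exact ⟨y, hy, hxy⟩

/-- A compact structure in which the sorts of the values of the functions are finite has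
arbitrarily dense finite substructures. -/
theorem Signature.Structure.IsCompact.exists_finite_subuniverse
    {N : Signature.Structure.{u, w} L} (h : N.IsCompact)
    (hcod : ∀ f, Finite (N.carrier (L.cod f))) {δ : ℝ} (hδ : 0 < δ) :
    ∃ F : N.Subuniverse, F.IsDense δ ∧ F.toStructure.IsFinite := by
  have := fun s => (h s : CompactSpace (N.carrier s))
  choose F hfin huniv hdense using fun s => exists_finite_net (Z := N.carrier s) hδ
  refine ⟨⟨F, fun s => ?_, fun s => (hfin s).isCompact.isComplete, fun f e _ => ?_⟩, hdense,
    fun s => (hfin s).to_subtype⟩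
  · obtain ⟨x⟩ := N.nonempty s
    obtain ⟨y, hy, -⟩ := hdense s x
    exact ⟨y, hy⟩
  · rw [huniv _ (hcod f)]
    trivial

/-! ### From finite structures to compact ones -/

theorem unitInterval_eq_zero_of_forall_le {s : unitInterval} (h : ∀ ε : ℝ, 0 < ε → (s : ℝ) ≤ ε) :
    s = 0 :=
  le_antisymm (show (s : ℝ) ≤ 0 from le_of_forall_pos_le_add fun ε hε => by
    rw [zero_add]; exact h ε hε) bot_le

theorem Sentence.value_eq_zero_of_isCompact {N : Signature.Structure.{u, w} L} (h : N.IsCompact)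
    (hcod : ∀ f, Finite (N.carrier (L.cod f))) {σ : Sentence L}
    (hσ : ∀ B : Signature.Structure.{u, w} L, B.IsFinite → σ.value B = 0) : σ.value N = 0 := by
  refine unitInterval_eq_zero_of_forall_le fun ε hε => ?_
  obtain ⟨δ, hδ, hd⟩ := Formula.exists_dist_eval_toStructure_le N σ hε
  obtain ⟨F, hF, hfin⟩ := h.exists_finite_subuniverse hcod hδ
  have h1 : dist (σ.value F.toStructure) (σ.value N) ≤ ε :=
    Eq.trans_le (congrArg (fun e => dist (σ.value F.toStructure) (Formula.eval N σ e))
      (Env.eq_nil (F.incl Env.nil)).symm) (hd F hF Env.nil)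
  rw [hσ _ hfin] at h1
  have h2 := (abs_sub_le_iff.1 (show |((0 : unitInterval) : ℝ) - σ.value N| ≤ ε from h1)).2
  simpa using h2

/-! ### Transfer to the eq expansion -/

/-- The connective `max(s - ε, 0)`. -/
def truncSub (ε : ℝ) (hε : 0 < ε) : C(Fin 1 → unitInterval, unitInterval) where
  toFun v := ⟨max ((v 0 : ℝ) - ε) 0, le_max_right _ _,
    max_le (by linarith [(v 0).2.2]) zero_le_one⟩
  continuous_toFun := Continuous.subtype_mk
    (((continuous_subtype_val.comp (continuous_apply 0)).sub continuous_const).max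
      continuous_const) _

theorem truncSub_eq_zero_iff {ε : ℝ} (hε : 0 < ε) (v : Fin 1 → unitInterval) :
    truncSub ε hε v = 0 ↔ (v 0 : ℝ) ≤ ε := by
  rw [Subtype.ext_iff]
  show max ((v 0 : ℝ) - ε) 0 = 0 ↔ _
  rw [max_eq_right_iff, sub_nonpos]

/-- The class `K` is kept abstract to serve both the finite and the compact structures. -/
theorem Sentence.value_eqOn_eq_zero {K : Signature.Structure.{u, w} L → Prop}
    {M : Signature.Structure.{u, w} L}
    (hM : ∀ τ : Sentence L, (∀ A, K A → τ.value A = 0) → τ.value M = 0)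
    {J : Set (Imaginary L)} {σ : Sentence (L.eqOn J)}
    (hσ : ∀ A, K A → σ.value (A.eqOn J) = 0) : σ.value (M.eqOn J) = 0 := by
  refine unitInterval_eq_zero_of_forall_le fun ε hε => ?_
  obtain ⟨τ, hτ⟩ := σ.exists_approximation.{u, w} (half_pos hε)
  -- The approximating τ need only be small on `K`; truncated subtraction of ε/2 turns this into
  -- exact vanishing, to which `hM` applies.
  have hc : ∀ A : Signature.Structure.{u, w} L,
      Sentence.value (.conn (truncSub _ (half_pos hε)) fun _ => τ) A = 0 ↔
        (τ.value A : ℝ) ≤ ε / 2 :=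
    fun A => truncSub_eq_zero_iff (half_pos hε) fun _ => τ.value A
  have hle := fun A => abs_sub_le_iff.1
    (show |(τ.value A : ℝ) - σ.value (A.eqOn J)| ≤ ε / 2 from hτ A)
  have h1 := (hc M).1 (hM _ fun A hA => (hc A).2 (by
    have h2 := (hle A).1
    rw [hσ A hA] at h2
    simpa using h2))
  linarith [(hle M).2]

namespace Signature.Structure

variable {M : Signature.Structure.{u, w} L}

theorem Pseudocompact.eqOn (h : M.Pseudocompact) (J : Set (Imaginary L)) :
    (M.eqOn J).Pseudocompact :=
  fun _ hσ => Sentence.value_eqOn_eq_zero h fun _ hA => hσ _ (hA.eqOn J)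

/-- The expansion of a finite structure is in general only compact, so the vanishing of σ there
comes from its finite substructures; all values of functions lie in the finite home sorts. -/
theorem Pseudofinite.eqOn (h : M.Pseudofinite) (J : Set (Imaginary L)) :
    (M.eqOn J).Pseudofinite :=
  fun _ hσ => Sentence.value_eqOn_eq_zero h fun _ hA =>
    Sentence.value_eq_zero_of_isCompact (hA.isCompact.eqOn J) (fun f => hA (L.cod f)) hσ

end Signature.Structure

end

end ContLogic

theorem mainTheorem7 (L : ContLogic.Signature.{u}) (M : ContLogic.Signature.Structure.{u, w} L) :
    ((M.Pseudofinite → M.eq.Pseudofinite) ∧ (M.Pseudocompact → M.eq.Pseudocompact)) ∧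
    ((M.Pseudofinite → M.eqFin.Pseudofinite) ∧ (M.Pseudocompact → M.eqFin.Pseudocompact)) ∧
    ((M.IsFinite → M.eqFin.IsFinite) ∧ (M.IsCompact → M.eq.IsCompact)) :=
  ⟨⟨fun h => h.eqOn _, fun h => h.eqOn _⟩, ⟨fun h => h.eqOn _, fun h => h.eqOn _⟩,
    ⟨fun h => h.eqOn fun _ hψ => hψ, fun h => h.eqOn _⟩⟩
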